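/- There is an absolute constant $C>0$ such that the following holds. Let $G=(V,E,\omega)$ be a finite weighted undirected simple graph with $n\ge 3$ nodes in which every edge has length at least $1$ and in which any two nodes are joined by exactly one shortest path; write $d_G$ for its distance, $P_{uv}$ for the shortest path from $u$ to $v$, and $L$ for its average edge length (so $L\ge 1$). For a node $u$ let $\widetilde T_u$ be the geometric realization of the shortest-path tree $T_u=\bigcup_v P_{uv}$ rooted at $u$ (each edge of length $\ell$ is replaced by a segment of length $\ell$), let the reach of a point of $\widetilde T_u$ be its distance to the furthest leaf in the subtree below it, and let $k$ be the skeleton dimension of $G$, i.e. the maximum, over all $u\in V$ and $r>0$, of the number of points of $\widetilde T_u$ at distance $r$ from $u$ whose reach is at least $r/2$. A $3$-hopset of $G$ is a set $H$ of node pairs (shortcuts) such that in $G\cup H$, where each $xy\in H$ has weight $d_G(x,y)$, every two nodes $u,v$ are joined by a walk with at most $3$ edges and length $d_G(u,v)$, and no walk with at most $3$ edges is shorter. An exact $3$-hopset distance oracle is a $3$-hopset $H=H_1\cup H_2$ together with an orientation of $H_1$, with out-neighbourhoods $N_1(u)$, such that for all $u,v\in V$ $$d_G(u,v)=\min\{d_G(u,x)+d_G(x,y)+d_G(y,v)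 : x\in N_1(u),\ y\in N_1(v),\ \{x,y\}\in H_2\}.$$ (Loops and pairs oriented in both directions are allowed.) It stores, for each node $u$, the list of all $(x,d_G(u,x))$ with $x\in N_1(u)$, and a hash map giving $d_G(x,y)$ for $\{x,y\}\in H_2$. A query for $(u,v)$ computes this minimum by running through all pairs of entries of the two lists, with one hash map look-up per pair; its time is the number of elementary steps, where a look-up, an addition, a comparison and a step along a list have unit cost. Then there is a randomized construction (a probability distribution on exact $3$-hopset distance oracles for $G$) such that, with certainty, the oracle has $$|H|\le C\,nk\log k\,(\log\log n+\log L)$$ shortcuts and every query takes time at most $$C\bigl(k^2\log^2k\,\log^2\log n\,(\log^2\log n+\log^2L)+\log^2n\bigr),$$ and such that for each pair $u,v\in V$ the expected time of the query for $(u,v)$, over the randomness of the construction, is at most $$C\,k^2\log^2k\,(\log^2\log n+\log^2L).$$ -/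

import Mathlib

open scoped ENNReal

noncomputable section

namespace HopsetOracles

/-! ### Weighted graphs: distances, shortest paths, unique shortest paths

A weighted graph is a simple graph `G` on `V` with a weight `w e` for each edge `e`
(values of `w` off the edge set are never used). -/

section Graph

variable {V : Type*}

/-- The length (total weight) of a walk. -/
def walkLength {G : SimpleGraph V} (w : Sym2 V → ℝ) {u v : V} (p : G.Walk u v) : ℝ :=
  (p.edges.map w).sum

/-- The distance `d_G(u,v)`: the least length of a walk from `u` to `v`. -/
def dist (G : SimpleGraph V) (w : Sym2 V → ℝ) (u v : V) : ℝ :=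
  ⨅ p : G.Walk u v, walkLength w p

theorem walkLength_reverse {G : SimpleGraph V} (w : Sym2 V → ℝ) {u v : V} (p : G.Walk u v) :
    walkLength w p.reverse = walkLength w p := by
  simp [walkLength, SimpleGraph.Walk.edges_reverse, List.sum_reverse]

theorem dist_comm (G : SimpleGraph V) (w : Sym2 V → ℝ) (u v : V) :
    dist G w u v = dist G w v u := by
  unfold dist
  refine Function.Surjective.iInf_congr (fun p => p.reverse) ?_ ?_
  · intro p
    exact ⟨p.reverse, p.reverse_reverse⟩
  · intro p
    exact walkLength_reverse w p

/-- The distance between the two ends of an unordered pair. -/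
def pairDist (G : SimpleGraph V) (w : Sym2 V → ℝ) : Sym2 V → ℝ :=
  Sym2.lift ⟨dist G w, dist_comm G w⟩

/-- `p` is a shortest path (with positive weights, a shortest walk is a path). -/
def IsShortest {G : SimpleGraph V} (w : Sym2 V → ℝ) {u v : V} (p : G.Walk u v) : Prop :=
  ∀ q : G.Walk u v, walkLength w p ≤ walkLength w q

/-- Unique shortest path graphs: any two nodes are joined by exactly one shortest path. In
particular such a graph is connected. -/
def IsUSP (G : SimpleGraph V) (w : Sym2 V → ℝ) : Prop :=
  ∀ u v : V, ∃! p : G.Walk u v, IsShortest w p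

/-- The average edge length of `G`. -/
def averageLength (G : SimpleGraph V) (w : Sym2 V → ℝ) : ℝ :=
  (∑ᶠ e ∈ G.edgeSet, w e) / (G.edgeSet.ncard : ℝ)

/-! ### Hopsets -/

/-- The `h`-limited distance: the least length of a walk with at most `h` edges
(`⊤` if there is none). -/
def hopDist (G : SimpleGraph V) (w : Sym2 V → ℝ) (h : ℕ) (u v : V) : EReal :=
  ⨅ (p : G.Walk u v) (_ : p.length ≤ h), ((walkLength w p : ℝ) : EReal)

open Classical in
/-- The weights of the augmented graph `G ∪ H`. -/
def augWeight (G : SimpleGraph V) (w : Sym2 V → ℝ) (H : Set (Sym2 V)) (e : Sym2 V) : ℝ :=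
  if e ∈ H then pairDist G w e else w e

/-- `H` is an exact `h`-hopset of `G`: the `h`-limited distances of `G ∪ H` are the distances
of `G`. (Loops in `H` are allowed; `fromEdgeSet` drops them, and they never matter for walks with
at most `h` edges.) -/
def IsHopset (G : SimpleGraph V) (w : Sym2 V → ℝ) (h : ℕ) (H : Set (Sym2 V)) : Prop :=
  ∀ u v : V, hopDist (G ⊔ SimpleGraph.fromEdgeSet H) (augWeight G w H) h u v
    = ((dist G w u v : ℝ) : EReal)

/-! ### Skeleton dimension -/

/-- `x` lies on the shortest path from `u` to `v`. -/
def OnShortestPath (G : SimpleGraph V) (w : Sym2 V → ℝ) (u v x : V) : Prop :=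
  ∃ p : G.Walk u v, IsShortest w p ∧ x ∈ p.support

/-- The arcs, directed away from the root, of the shortest path tree `T_u`, which is the union
of the shortest paths starting at `u`. -/
def TreeArc (G : SimpleGraph V) (w : Sym2 V → ℝ) (u x y : V) : Prop :=
  ∃ (v : V) (p : G.Walk u v), IsShortest w p ∧ ∃ a ∈ p.darts, a.fst = x ∧ a.snd = y

/-- The points other than the root of the geometric realization of the tree `T_u`: the point at
fraction `frac ∈ (0,1]` of a tree arc from `src` to `tgt`. Each non-root vertex of the tree is the
point at fraction `1` of the unique arc entering it, so every non-root point of the realization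
occurs exactly once. -/
@[ext]
structure TreePoint (G : SimpleGraph V) (w : Sym2 V → ℝ) (u : V) where
  src : V
  tgt : V
  frac : ℝ
  arc : TreeArc G w u src tgt
  frac_pos : 0 < frac
  frac_le_one : frac ≤ 1

/-- The distance in the realization of `T_u` from the root to a point. -/
def TreePoint.depth {G : SimpleGraph V} {w : Sym2 V → ℝ} {u : V} (x : TreePoint G w u) : ℝ :=
  dist G w u x.src + x.frac * w s(x.src, x.tgt)

/-- The reach of a point: the largest distance from it to a vertex of the subtree below it. -/
def TreePoint.reach {G : SimpleGraph V} {w : Sym2 V → ℝ} {u : V} (x : TreePoint G w u) : ℝ :=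
  ⨆ z : {z : V // OnShortestPath G w u z x.tgt}, (dist G w u z - x.depth)

/-- The cut at distance `r > 0` from the root of the `α`-skeleton of `T_u`: the points at depth
`r` whose reach is at least `α` times their depth. -/
def skeletonCut (G : SimpleGraph V) (w : Sym2 V → ℝ) (α : ℝ) (u : V) (r : ℝ) :
    Set (TreePoint G w u) :=
  {x | x.depth = r ∧ α * x.depth ≤ x.reach}

/-- The `α`-skeleton dimension of a unique shortest path graph: the maximum width of a cut of the
`α`-skeleton of a shortest path tree. -/
def alphaSkeletonDim (G : SimpleGraph V) (w : Sym2 V → ℝ) (α : ℝ) : ℕ∞ :=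
  ⨆ (u : V) (r : ℝ) (_ : 0 < r), (skeletonCut G w α u r).encard

/-- The skeleton dimension, `α = 1 / 2`. -/
def skeletonDim (G : SimpleGraph V) (w : Sym2 V → ℝ) : ℕ∞ :=
  alphaSkeletonDim G w (1 / 2)

end Graph

/-! ### Distance oracles from 3-hopsets -/

/-- The outcome of a computation together with the number of steps that it took. -/
structure Timed (α : Type*) where
  value : α
  time : ℕ

/-- A candidate 3-hopset `H = H₁ ∪ H₂`, given by the oriented first/last hops `arcs` (`H₁` with its
orientation: `(w, x)` says that `wx` may be the first hop from `w` or the last hop to `w`) and the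
middle hops `mid` (`H₂`). -/
@[ext]
structure HopsetOracle (V : Type*) where
  arcs : Finset (V × V)
  mid : Finset (Sym2 V)

section Query

variable {V : Type*} [DecidableEq V]

/-- The inner loop of a query: `x` is at stored distance `a` from the first queried node, the list
is what remains of the stored list of the second queried node, and `best` is the least length found
so far. Steps: a test for the end of the list and one look-up in the hash map for every entry and,
if the look-up succeeds, two additions and one comparison. -/
def scanInner (table : Sym2 V → Option ℝ) (x : V) (a : ℝ) :
    List (V × ℝ) → WithTop ℝ → Timed (WithTop ℝ)
  | [], best => ⟨best, 1⟩
  | (y, b) :: l, best =>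
    match table s(x, y) with
    | some m =>
      let r := scanInner table x a l (min best ((a + m + b : ℝ) : WithTop ℝ))
      ⟨r.value, r.time + 5⟩
    | none =>
      let r := scanInner table x a l best
      ⟨r.value, r.time + 2⟩

/-- The outer loop of a query, over the stored list of the first queried node. -/
def scanOuter (table : Sym2 V → Option ℝ) (l₂ : List (V × ℝ)) :
    List (V × ℝ) → WithTop ℝ → Timed (WithTop ℝ)
  | [], best => ⟨best, 1⟩
  | (x, a) :: l, best =>
    let r₁ := scanInner table x a l₂ best
    let r₂ := scanOuter table l₂ l r₁.value
    ⟨r₂.value, r₁.time + r₂.time + 1⟩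

namespace HopsetOracle

/-- The set of shortcuts `H = H₁ ∪ H₂` as unordered pairs. -/
def shortcuts (o : HopsetOracle V) : Finset (Sym2 V) :=
  o.arcs.image (fun a => s(a.1, a.2)) ∪ o.mid

/-- The out-neighbourhood `N₁(u)`. -/
def out (o : HopsetOracle V) (u : V) : Finset V :=
  (o.arcs.filter (fun a => a.1 = u)).image Prod.snd

/-- The list stored at `u`: the out-neighbours of `u` with their distances from `u`. -/
def stored (G : SimpleGraph V) (w : Sym2 V → ℝ) (o : HopsetOracle V) (u : V) : List (V × ℝ) :=
  (o.out u).toList.map (fun x => (x, dist G w u x))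

/-- The hash map from the middle hops to their lengths. -/
def table (G : SimpleGraph V) (w : Sym2 V → ℝ) (o : HopsetOracle V) (e : Sym2 V) : Option ℝ :=
  if e ∈ o.mid then some (pairDist G w e) else none

/-- The query for the pair `u, v`: minimize `d(u,x) + d(x,y) + d(y,v)` over the pairs
`x ∈ N₁(u)`, `y ∈ N₁(v)` with `{x,y} ∈ H₂`. It reads only the two stored lists and the hash map. -/
def query (G : SimpleGraph V) (w : Sym2 V → ℝ) (o : HopsetOracle V) (u v : V) :
    Timed (WithTop ℝ) :=
  scanOuter (o.table G w) (o.stored G w v) (o.stored G w u) ⊤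

/-- `o` is a 3-hopset distance oracle for `G`: its shortcuts form an exact 3-hopset, and every
query returns the exact distance. -/
def IsExact (G : SimpleGraph V) (w : Sym2 V → ℝ) (o : HopsetOracle V) : Prop :=
  IsHopset G w 3 (o.shortcuts : Set (Sym2 V)) ∧
    ∀ u v : V, (o.query G w u v).value = ((dist G w u v : ℝ) : WithTop ℝ)

end HopsetOracle

end Query

end HopsetOracles

end

/-! Everything takes place in the shortest-path metric, which is geodetic: the points between two
given points are linearly ordered. Distances are split into scales. At each scale the two ends of a
geodesic must choose hubs on it without knowing each other. The skeleton dimension makes this cheap: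
the geodesics from `v` that continue by `r / 2` beyond depth `r` use at most `k` arcs at depth `r`,
so one hub per arc costs `k` label entries. It remains to choose the hubs so that few middle hops
occur. Candidates are tickets, points spaced about `1 / 96` apart along the arcs, so that a long arc
offers as many candidates as a path of short ones.

Short scales, distances in `[R, 5R/4)` (`exists_short_scale`): under a random ranking of the
tickets, `v` chooses the first ticket in a window on each geodesic, and `u` is joined directly to
it. Seen from `u`, the chosen ticket is first in one of two adjacent blocks below one of `O(k)` cut
arcs. Since a ticket is first in a block of size `≥ R` with probability at most `1 / R`, the
expected number of hops at `u` is `O(k)`.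

Long scales, distances in `[R, λR)` (`exists_long_scale`): a random sample of density about `log n /
R` hits every window of length `R / 6`. The sampled tickets of the two ends are joined. By
`card_cutSet_le` a ticket has at most about `λ R k^(log_3 λ + 2)` partners, up to constants, and
both ends of a pair are sampled with probability about `(log n / R)^2`. Hence `O(n)` hops suffice
once `R` is at least a factor `T'` times `λ^g`, where `g` is about `log_3 k`.

The admissible `λ` therefore grows as `2^(θ^i)` with `θ = 1 + 1/g`, and `O(log k log log n)` long
scales reach the diameter (`exists_labels_of_scales`). The starting distance `T' 2^g` is covered by
`O(log T' + g)` short scales. The average length `L` enters only through the number of tickets per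
node in `T'`: half of the edges have length at most `2L`, and balls grow polynomially with exponent
`O(log k)` (`card_ball_le`, `card_edges_le`). Altogether there are `O(log k (log log n + log L))`
scales. The query time is the product of two label sizes (`exists_graph_labels`,
`isExact_oracleOfLabels`). -/

noncomputable section

namespace HopsetOracles

/-! ### Geodetic metrics -/

/-- A metric with distances at least `1` between distinct points in which the points between two
given points are linearly ordered, as on a unique shortest path. -/
structure IsGeodetic {V : Type*} (d : V → V → ℝ) : Prop where
  self : ∀ u, d u u = 0
  comm : ∀ u v, d u v = d v u
  tri : ∀ u x v, d u v ≤ d u x + d x v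
  one_le : ∀ u v, u ≠ v → 1 ≤ d u v
  linear : ∀ u v x y, d u x + d x v = d u v → d u y + d y v = d u v → d u x ≤ d u y →
    d u x + d x y = d u y

/-- `x` lies between `u` and `v`. -/
def Btw {V : Type*} (d : V → V → ℝ) (u x v : V) : Prop := d u x + d x v = d u v

/-- The arc from `a` to `b` lies between `u` and `v`. -/
def Trav {V : Type*} (d : V → V → ℝ) (u a b v : V) : Prop := d u a + d a b + d b v = d u v

/-- No point lies strictly between `a` and `b`. -/
def Edge {V : Type*} (d : V → V → ℝ) (a b : V) : Prop :=
  a ≠ b ∧ ∀ x, Btw d a x b → x = a ∨ x = b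

/-- The arc from `a` to `b` is the arc at distance `r` from `u` on some geodesic from `u`. -/
def Crosses {V : Type*} (d : V → V → ℝ) (u : V) (r : ℝ) (a b : V) : Prop :=
  Edge d a b ∧ Btw d u a b ∧ d u a < r ∧ r ≤ d u b

open Classical in
/-- The heads of the arcs at distance `r` from `u` on the geodesics from `u` that go on for at
least `η`. -/
def cutSet {V : Type*} [Fintype V] (d : V → V → ℝ) (u : V) (r η : ℝ) : Finset V :=
  Finset.univ.filter fun b => (∃ a, Crosses d u r a b) ∧ ∃ v, Btw d u b v ∧ r + η ≤ d u v

section Geodetic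

variable {V : Type*} {d : V → V → ℝ}

theorem mem_cutSet [Fintype V] {u b : V} {r η : ℝ} :
    b ∈ cutSet d u r η ↔ (∃ a, Crosses d u r a b) ∧ ∃ v, Btw d u b v ∧ r + η ≤ d u v := by
  simp [cutSet]

namespace IsGeodetic

variable (hd : IsGeodetic d)
include hd

theorem nonneg (u v : V) : 0 ≤ d u v := by
  by_cases h : u = v
  · rw [h, hd.self]
  · linarith [hd.one_le u v h]

theorem eq_of_le_zero {u v : V} (h : d u v ≤ 0) : u = v := by
  by_contra hne
  linarith [hd.one_le u v hne]

theorem btw_symm {u x v : V} (h : Btw d u x v) : Btw d v x u := by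
  unfold Btw at *
  rw [hd.comm v x, hd.comm x u, hd.comm v u]; linarith

theorem edge_symm {a b : V} (h : Edge d a b) : Edge d b a :=
  ⟨h.1.symm, fun x hx => (h.2 x (hd.btw_symm hx)).symm⟩

theorem trav_symm {u a b v : V} (h : Trav d u a b v) : Trav d v b a u := by
  unfold Trav at *
  rw [hd.comm v b, hd.comm b a, hd.comm a u, hd.comm v u]; linarith

theorem trav_btw {u a b v : V} (h : Trav d u a b v) :
    Btw d u a b ∧ Btw d u a v ∧ Btw d u b v ∧ Btw d a b v := by
  unfold Trav at h; unfold Btw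
  have h1 := hd.tri u a b
  have h2 := hd.tri u b v
  have h3 := hd.tri u a v
  have h4 := hd.tri a b v
  refine ⟨?_, ?_, ?_, ?_⟩ <;> linarith

omit hd in
theorem trav_of_btw {u a b v : V} (h1 : Btw d u a b) (h2 : Btw d u b v) : Trav d u a b v := by
  unfold Btw at *; unfold Trav; linarith

theorem btw_linear {u v x y : V} (hx : Btw d u x v) (hy : Btw d u y v) (h : d u x ≤ d u y) :
    Btw d u x y := hd.linear u v x y hx hy h

theorem btw_trans {u x y v : V} (h1 : Btw d u x y) (h2 : Btw d u y v) :
    Btw d u x v ∧ Btw d x y v := by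
  unfold Btw at *
  have h3 := hd.tri u x v
  have h4 := hd.tri x y v
  constructor <;> linarith

/-- A point between `u` and `v` is not inside an arc between `u` and `v`. -/
theorem edge_vertex {u a b v x : V} (he : Edge d a b) (ht : Trav d u a b v) (hx : Btw d u x v) :
    d u x ≤ d u a ∨ d u b ≤ d u x := by
  by_contra hcon
  push Not at hcon
  obtain ⟨hab, hav, hbv, -⟩ := hd.trav_btw ht
  have h1 := hd.btw_linear hav hx hcon.1.le
  have h2 := hd.btw_linear hx hbv hcon.2.le
  have h3 : Btw d a x b := by unfold Btw at *; linarith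
  rcases he.2 x h3 with rfl | rfl
  · exact lt_irrefl _ hcon.1
  · exact lt_irrefl _ hcon.2

/-- Two arcs between `u` and `v` are equal or one comes before the other. -/
theorem edge_edge {u a b v a' b' : V} (he : Edge d a b) (ht : Trav d u a b v)
    (he' : Edge d a' b') (ht' : Trav d u a' b' v) :
    (a = a' ∧ b = b') ∨ d u b ≤ d u a' ∨ d u b' ≤ d u a := by
  obtain ⟨hab, hav, hbv, -⟩ := hd.trav_btw ht
  obtain ⟨hab', hav', hbv', -⟩ := hd.trav_btw ht'
  have key : ∀ x y : V, Btw d u x v → Btw d u y v → d u x = d u y → x = y := by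
    intro x y hx hy h
    have := hd.btw_linear hx hy h.le
    unfold Btw at this
    exact hd.eq_of_le_zero (by linarith)
  rcases hd.edge_vertex he ht hav' with h1 | h1
  · rcases hd.edge_vertex he ht hbv' with h2 | h2
    · exact Or.inr (Or.inr h2)
    · rcases hd.edge_vertex he' ht' hav with h3 | h3
      · rcases hd.edge_vertex he' ht' hbv with h4 | h4
        · exact Or.inr (Or.inl h4)
        · left
          exact ⟨key _ _ hav hav' (le_antisymm h3 h1), key _ _ hbv hbv' (le_antisymm h2 h4)⟩
      · exact Or.inr (Or.inr h3)
  · exact Or.inr (Or.inl h1)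

theorem edge_one_le {a b : V} (he : Edge d a b) : 1 ≤ d a b := hd.one_le a b he.1

/-- Every distance in `(0, d u v]` is the distance from `u` of an interior point or the head of an
arc between `u` and `v`. -/
theorem exists_crosses [Finite V] {u v : V} {r : ℝ} (hr : 0 < r) (hrv : r ≤ d u v) :
    ∃ a b, Crosses d u r a b ∧ Trav d u a b v := by
  -- The tail `a` is the last point before depth `r` and the head `b` the first point at depth at
  -- least `r`; their extremality leaves nothing between them.
  have hA : {x | Btw d u x v ∧ d u x < r}.Nonempty :=
    ⟨u, by unfold Btw; rw [hd.self]; ring, by rw [hd.self]; exact hr⟩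
  have hB : {x | Btw d u x v ∧ r ≤ d u x}.Nonempty :=
    ⟨v, by unfold Btw; rw [hd.self]; ring, hrv⟩
  obtain ⟨a, ⟨ha, har⟩, hamax⟩ := Set.exists_max_image _ (d u) (Set.toFinite _) hA
  obtain ⟨b, ⟨hb, hbr⟩, hbmin⟩ := Set.exists_min_image _ (d u) (Set.toFinite _) hB
  have hab : Btw d u a b := hd.btw_linear ha hb (by linarith)
  refine ⟨a, b, ⟨⟨?_, ?_⟩, hab, har, hbr⟩, IsGeodetic.trav_of_btw hab hb⟩
  · rintro rfl; linarith
  · intro x hx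
    have h1 : Btw d u x b := by
      unfold Btw at *
      have h2 := hd.tri u a x
      have h3 := hd.tri u x b
      linarith
    have h4 : d u x = d u a + d a x := by
      unfold Btw at *; linarith
    have h2 := (hd.btw_trans h1 hb).1
    rcases lt_or_ge (d u x) r with h3 | h3
    · have := hamax x ⟨h2, h3⟩
      exact Or.inl (hd.eq_of_le_zero (by linarith)).symm
    · have := hbmin x ⟨h2, h3⟩
      right
      unfold Btw at h1
      exact hd.eq_of_le_zero (by linarith)

end IsGeodetic

/-! ### Widths of cuts and growth of balls -/

section Width

variable [Fintype V] (hd : IsGeodetic d) {k : ℕ}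
  (hk : ∀ u r, 0 < r → (cutSet d u r (r / 2)).card ≤ k)
include hd hk

/-- The defining bound covers only `η ≥ r / 2`. For smaller `η`, pass through an earlier cut of the
skeleton, at the cost of a factor `k`; the radius left to cover is then at most `r / 3`. After `j`
such steps it is at most `2 * η`. -/
theorem card_cutSet_le (j : ℕ) : ∀ (u : V) (r η : ℝ), 0 < r → 0 < η → r ≤ 2 * η * 3 ^ j →
    (cutSet d u r η).card ≤ k ^ (j + 1) := by
  classical
  have base : ∀ (u : V) (r η : ℝ), 0 < r → r ≤ 2 * η → (cutSet d u r η).card ≤ k := by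
    intro u r η hr h
    refine (Finset.card_le_card ?_).trans (hk u r hr)
    intro b hb
    rw [mem_cutSet] at hb ⊢
    obtain ⟨h1, v, h2, h3⟩ := hb
    exact ⟨h1, v, h2, by linarith⟩
  induction j with
  | zero =>
    intro u r η hr hη h
    simpa using base u r η hr (by simpa using h)
  | succ j ih =>
    intro u r η hr hη h
    rcases le_or_gt r (2 * η) with h0 | h0
    · refine (base u r η hr h0).trans ?_
      rcases Nat.eq_zero_or_pos k with hk0 | hk0
      · rw [hk0]; exact Nat.zero_le _
      · exact Nat.le_self_pow (by omega) k
    -- The largest depth at which a geodesic of length `r + η` still goes on for half the depth: `s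
    -- + s / 2 = r + η`.
    set s : ℝ := 2 * (r + η) / 3 with hs
    have hs0 : 0 < s := by positivity
    have hsr : s < r := by rw [hs]; linarith
    have hsub : cutSet d u r η ⊆ (cutSet d u s (s / 2)).biUnion fun z =>
        if d u z < r then cutSet d z (r - d u z) η else {z} := by
      intro b hb
      rw [mem_cutSet] at hb
      obtain ⟨⟨a, hE, hab, har, hrb⟩, v, hbv, hv⟩ := hb
      obtain ⟨x, z, ⟨hE', hxz, hxs, hsz⟩, ht⟩ :=
        hd.exists_crosses (u := u) (v := v) hs0 (by linarith)
      have htab := IsGeodetic.trav_of_btw hab hbv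
      obtain ⟨-, hav, -, -⟩ := hd.trav_btw htab
      obtain ⟨-, hxv, hzv, -⟩ := hd.trav_btw ht
      rw [Finset.mem_biUnion]
      refine ⟨z, ?_, ?_⟩
      · rw [mem_cutSet]
        exact ⟨⟨x, hE', hxz, hxs, hsz⟩, v, hzv, by rw [hs]; linarith⟩
      · split_ifs with hzr
        · rw [mem_cutSet]
          have hza : d u z ≤ d u a := by
            rcases hd.edge_vertex hE htab hzv with h1 | h1
            · exact h1
            · linarith
          have hzA : Btw d u z a := hd.btw_linear hzv hav hza
          have hzB : Btw d u z b := hd.btw_linear hzv hbv (by linarith)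
          unfold Btw at *
          exact ⟨⟨a, hE, show d z a + d a b = d z b by linarith, by linarith, by linarith⟩, v,
            show d z b + d b v = d z v by linarith, by linarith⟩
        -- Here the arc crossing depth `s` already reaches depth `r`, so it is the arc from `a` to
        -- `b`.
        · rw [Finset.mem_singleton]
          rcases hd.edge_edge hE htab hE' ht with h1 | h1 | h1
          · exact h1.2
          · linarith
          · linarith
    refine (Finset.card_le_card hsub).trans (Finset.card_biUnion_le.trans ?_)
    refine (Finset.sum_le_card_nsmul _ _ (k ^ (j + 1)) ?_).trans ?_
    · intro z hz
      have hkpos : 1 ≤ k := by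
        have := hk u s hs0
        have := Finset.card_pos.mpr ⟨z, hz⟩
        omega
      split_ifs with hzr
      · rw [mem_cutSet] at hz
        obtain ⟨⟨x, -, -, -, hsz⟩, -⟩ := hz
        refine ih z (r - d u z) η (by linarith) hη ?_
        rw [pow_succ] at h
        rw [hs] at hsz
        have : r - d u z ≤ r / 3 := by linarith
        linarith
      · simpa using Nat.one_le_pow _ _ hkpos
    · rw [smul_eq_mul, pow_succ k (j + 1), mul_comm]
      exact Nat.mul_le_mul_left _ (hk u s hs0)

-- A point near the boundary of the ball lies behind a skeleton cut at depth `ρ / 2`. Thus the ball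
-- is covered by `k + 1` balls whose radius is smaller by the factor `3 / 4`.
open Classical in
theorem card_ball_le (j : ℕ) : ∀ (u : V) (ρ : ℝ), ρ < (4 / 3 : ℝ) ^ j →
    (Finset.univ.filter fun v => d u v ≤ ρ).card ≤ (k + 1) ^ j := by
  induction j with
  | zero =>
    intro u ρ h
    simp only [pow_zero] at h ⊢
    rw [Finset.card_le_one]
    have key : ∀ v, d u v ≤ ρ → u = v := fun v hv => by
      by_contra hne
      linarith [hd.one_le u v hne]
    intro a ha b hb
    simp only [Finset.mem_filter, Finset.mem_univ, true_and] at ha hb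
    rw [← key a ha, ← key b hb]
  | succ j ih =>
    intro u ρ h
    rw [pow_succ] at h
    have hlt : 3 * ρ / 4 < (4 / 3 : ℝ) ^ j := by linarith
    rcases le_or_gt ρ 0 with h0 | h0
    · refine (ih u ρ (by linarith)).trans (Nat.pow_le_pow_right (by omega) (by omega))
    -- Beyond `3 * ρ / 4` the geodesic continues for at least `ρ / 4` past depth `ρ / 2`, and its
    -- end is within `ρ / 2` of the head of the cut.
    have hsub : (Finset.univ.filter fun v => d u v ≤ ρ) ⊆
        (Finset.univ.filter fun v => d u v ≤ 3 * ρ / 4) ∪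
          (cutSet d u (ρ / 2) (ρ / 2 / 2)).biUnion fun z =>
            Finset.univ.filter fun v => d z v ≤ 3 * ρ / 4 := by
      intro v hv
      simp only [Finset.mem_filter, Finset.mem_univ, true_and] at hv
      rw [Finset.mem_union, Finset.mem_biUnion]
      simp only [Finset.mem_filter, Finset.mem_univ, true_and]
      rcases le_or_gt (d u v) (3 * ρ / 4) with h1 | h1
      · exact Or.inl h1
      · right
        obtain ⟨a, z, hc, ht⟩ :=
          hd.exists_crosses (u := u) (v := v) (r := ρ / 2) (by linarith) (by linarith)
        obtain ⟨-, -, hzv, -⟩ := hd.trav_btw ht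
        refine ⟨z, ?_, ?_⟩
        · rw [mem_cutSet]
          exact ⟨⟨a, hc⟩, v, hzv, by linarith⟩
        · have := hc.2.2.2
          unfold Btw at hzv
          linarith
    refine (Finset.card_le_card hsub).trans ((Finset.card_union_le _ _).trans ?_)
    have h2 := Finset.card_biUnion_le_card_mul (cutSet d u (ρ / 2) (ρ / 2 / 2))
      (fun z => Finset.univ.filter fun v => d z v ≤ 3 * ρ / 4) ((k + 1) ^ j)
      (fun z _ => ih z _ hlt)
    have h3 := Nat.mul_le_mul_right ((k + 1) ^ j) (hk u (ρ / 2) (by linarith))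
    have h4 := ih u _ hlt
    rw [pow_succ]
    nlinarith

end Width

end Geodetic

/-! ### Tickets: equally spaced points on the arcs -/

/-- The number of tickets on an arc of length `x`. -/
def pieces (x : ℝ) : ℕ := ⌈96 * x⌉₊

/-- The offset of the `i`-th of `N` equally spaced points on an arc of length `ℓ`. -/
def offset (ℓ : ℝ) (N i : ℕ) : ℝ := ℓ * (2 * i + 1) / (2 * N)

theorem pieces_pos {x : ℝ} (hx : 1 ≤ x) : 0 < pieces x := Nat.ceil_pos.mpr (by linarith)

theorem le_pieces (x : ℝ) : 96 * x ≤ pieces x := Nat.le_ceil _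

theorem pieces_le {x : ℝ} (hx : 1 ≤ x) : (pieces x : ℝ) ≤ 97 * x := by
  have := (Nat.ceil_lt_add_one (show (0 : ℝ) ≤ 96 * x by linarith)).le
  unfold pieces
  linarith

/-- Rounding up adds at most `1 ≤ x` piece, so a cell has length between `1 / 97` and `1 / 96`. -/
theorem half_cell_bounds {x : ℝ} (hx : 1 ≤ x) :
    1 / 194 ≤ x / (2 * pieces x) ∧ x / (2 * pieces x) ≤ 1 / 192 := by
  have h0 : (0 : ℝ) < pieces x := by exact_mod_cast pieces_pos hx
  have h1 := le_pieces x
  have h2 := pieces_le hx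
  constructor
  · rw [div_le_div_iff₀ (by norm_num) (by positivity)]; linarith
  · rw [div_le_div_iff₀ (by positivity) (by norm_num)]; linarith

theorem offset_eq (ℓ : ℝ) {N : ℕ} (i : ℕ) :
    offset ℓ N i = ℓ / (2 * N) * (2 * i + 1) := by
  unfold offset; ring

theorem offset_bounds {ℓ : ℝ} (hℓ : 1 ≤ ℓ) {i : ℕ} (hi : i < pieces ℓ) :
    1 / 194 ≤ offset ℓ (pieces ℓ) i ∧ offset ℓ (pieces ℓ) i + 1 / 194 ≤ ℓ := by
  have h0 : (0 : ℝ) < pieces ℓ := by exact_mod_cast pieces_pos hℓ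
  obtain ⟨h1, -⟩ := half_cell_bounds hℓ
  have h2 : ℓ / (2 * pieces ℓ) * (2 * pieces ℓ) = ℓ := by field_simp
  have hi' : (i : ℝ) + 1 ≤ pieces ℓ := by exact_mod_cast hi
  have hi0 : (0 : ℝ) ≤ i := Nat.cast_nonneg i
  rw [offset_eq]
  generalize ℓ / (2 * (pieces ℓ : ℝ)) = c at *
  constructor
  · nlinarith
  · nlinarith

theorem offset_sep {ℓ : ℝ} (hℓ : 1 ≤ ℓ) {i j : ℕ} (hij : i ≠ j) :
    1 / 97 ≤ |offset ℓ (pieces ℓ) i - offset ℓ (pieces ℓ) j| := by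
  obtain ⟨h1, -⟩ := half_cell_bounds hℓ
  have h3 : (1 : ℝ) ≤ |(i : ℝ) - j| := by
    have : (1 : ℤ) ≤ |(i : ℤ) - j| := Int.one_le_abs (by omega)
    exact_mod_cast this
  rw [offset_eq, offset_eq]
  generalize ℓ / (2 * (pieces ℓ : ℝ)) = c at *
  rw [show c * (2 * (i : ℝ) + 1) - c * (2 * j + 1) = 2 * c * (i - j) by ring, abs_mul,
    abs_of_pos (by linarith)]
  nlinarith

theorem exists_offset {ℓ t : ℝ} (hℓ : 1 ≤ ℓ) (h0 : 0 ≤ t) (ht : t ≤ ℓ) :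
    ∃ i, i < pieces ℓ ∧ |offset ℓ (pieces ℓ) i - t| ≤ 1 / 192 := by
  have hN : 0 < pieces ℓ := pieces_pos hℓ
  have hN' : (0 : ℝ) < pieces ℓ := by exact_mod_cast hN
  obtain ⟨h1, h1'⟩ := half_cell_bounds hℓ
  have h2 : ℓ / (2 * pieces ℓ) * (2 * pieces ℓ) = ℓ := by field_simp
  simp only [offset_eq]
  set c := ℓ / (2 * (pieces ℓ : ℝ)) with hc
  have hc0 : 0 < c := by linarith
  rcases eq_or_lt_of_le ht with rfl | htl
  -- At the far end of the arc the floor would give the index `pieces t`, which is out of range; the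
  -- last cell is used instead.
  · refine ⟨pieces t - 1, by omega, ?_⟩
    rw [Nat.cast_sub hN, abs_le]
    push_cast
    constructor <;> nlinarith
  · refine ⟨⌊t / (2 * c)⌋₊, ?_, ?_⟩
    · rw [Nat.floor_lt (by positivity), div_lt_iff₀ (by positivity)]
      linarith
    · have h4 := Nat.floor_le (show 0 ≤ t / (2 * c) by positivity)
      have h5 := Nat.lt_floor_add_one (t / (2 * c))
      rw [le_div_iff₀ (by positivity)] at h4
      rw [div_lt_iff₀ (by positivity)] at h5
      rw [abs_le]
      constructor <;> nlinarith

section Tickets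

variable {V : Type*} [LinearOrder V] {d : V → V → ℝ}

/-- The arcs, each with the orientation given by the linear order. -/
def OrientedEdge (d : V → V → ℝ) : Type _ := {e : V × V // e.1 < e.2 ∧ Edge d e.1 e.2}

instance [Finite V] : Finite (OrientedEdge d) := Subtype.finite

/-- Equally spaced points on the arcs. -/
abbrev Ticket (d : V → V → ℝ) : Type _ :=
  Σ e : OrientedEdge d, Fin (pieces (d e.1.1 e.1.2))

instance [Finite V] : Fintype (OrientedEdge d) := Fintype.ofFinite _

instance : DecidableEq (OrientedEdge d) := Classical.decEq _

namespace Ticket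

/-- The first end of the arc of a ticket. -/
def fst (p : Ticket d) : V := p.1.1.1

/-- The second end of the arc of a ticket. -/
def snd (p : Ticket d) : V := p.1.1.2

/-- The distance of a ticket from the first end of its arc. -/
def off (p : Ticket d) : ℝ := offset (d p.fst p.snd) (pieces (d p.fst p.snd)) p.2

/-- The distance of a ticket from a point. -/
def depth (p : Ticket d) (u : V) : ℝ :=
  min (d u p.fst + p.off) (d u p.snd + d p.fst p.snd - p.off)

/-- The ticket lies between `u` and `v`. -/
def On (p : Ticket d) (u v : V) : Prop :=
  Trav d u p.fst p.snd v ∨ Trav d u p.snd p.fst v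

theorem edge (p : Ticket d) : Edge d p.fst p.snd := p.1.2.2

theorem fst_lt_snd (p : Ticket d) : p.fst < p.snd := p.1.2.1

end Ticket

/-! ### Positions of tickets on geodesics -/

namespace IsGeodetic

variable (hd : IsGeodetic d)
include hd

theorem off_bounds (p : Ticket d) : 1 / 194 ≤ p.off ∧ p.off + 1 / 194 ≤ d p.fst p.snd :=
  offset_bounds (hd.edge_one_le p.edge) p.2.2

theorem on_symm {p : Ticket d} {u v : V} (h : p.On u v) : p.On v u :=
  h.elim (fun h => Or.inr (hd.trav_symm h)) fun h => Or.inl (hd.trav_symm h)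

theorem depth_of_btw_fst {p : Ticket d} {u : V} (h : Btw d u p.fst p.snd) :
    p.depth u = d u p.fst + p.off := by
  have := hd.off_bounds p
  unfold Btw at h
  exact min_eq_left (by linarith)

theorem depth_of_btw_snd {p : Ticket d} {u : V} (h : Btw d u p.snd p.fst) :
    p.depth u = d u p.snd + d p.fst p.snd - p.off := by
  have := hd.off_bounds p
  unfold Btw at h
  rw [hd.comm p.snd] at h
  exact min_eq_right (by linarith)

/-- Normal form for tickets on a geodesic: the arc is reoriented to point away from `u`, whichever
way the linear order directs it. The margins `1 / 194` are half the least cell length; they make the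
position strictly interior to the arc. -/
theorem on_cases {p : Ticket d} {u v : V} (h : p.On u v) :
    ∃ a b, Edge d a b ∧ Trav d u a b v ∧ d u a + 1 / 194 ≤ p.depth u ∧
      p.depth u + 1 / 194 ≤ d u b ∧ p.depth u + p.depth v = d u v ∧
      ((a = p.fst ∧ b = p.snd ∧ p.depth u = d u a + p.off) ∨
        (a = p.snd ∧ b = p.fst ∧ p.depth u = d u a + d p.fst p.snd - p.off)) := by
  have hb := hd.off_bounds p
  rcases h with h | h
  · have h1 := (hd.trav_btw h).1
    have h2 := (hd.trav_btw (hd.trav_symm h)).1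
    rw [hd.depth_of_btw_fst h1, hd.depth_of_btw_snd h2]
    refine ⟨_, _, p.edge, h, ?_, ?_, ?_, Or.inl ⟨rfl, rfl, rfl⟩⟩
    · linarith
    · unfold Btw at h1; linarith
    · unfold Trav at h
      rw [hd.comm v p.snd]; linarith
  · have h1 := (hd.trav_btw h).1
    have h2 := (hd.trav_btw (hd.trav_symm h)).1
    rw [hd.depth_of_btw_snd h1, hd.depth_of_btw_fst h2]
    refine ⟨_, _, hd.edge_symm p.edge, h, ?_, ?_, ?_, Or.inr ⟨rfl, rfl, rfl⟩⟩
    · linarith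
    · unfold Btw at h1
      rw [hd.comm p.snd p.fst] at h1; linarith
    · unfold Trav at h
      rw [hd.comm p.snd p.fst] at h
      rw [hd.comm v p.fst]; linarith

theorem on_btw {p : Ticket d} {u v : V} (h : p.On u v) : Btw d u p.fst v :=
  h.elim (fun h => (hd.trav_btw h).2.1) fun h => (hd.trav_btw h).2.2.1

theorem on_depth_add {p : Ticket d} {u v : V} (h : p.On u v) :
    p.depth u + p.depth v = d u v := by
  obtain ⟨_, _, -, -, -, -, h, -⟩ := hd.on_cases h
  exact h

theorem on_depth_pos {p : Ticket d} {u v : V} (h : p.On u v) : 0 < p.depth u := by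
  obtain ⟨a, _, -, -, h, -⟩ := hd.on_cases h
  linarith [hd.nonneg u a]

theorem on_extend {p : Ticket d} {u b v : V} (h : p.On u b) (hb : Btw d u b v) : p.On u v := by
  have key : ∀ x y, Trav d u x y b → Trav d u x y v := fun x y ht => by
    obtain ⟨h1, -, h2, -⟩ := hd.trav_btw ht
    exact trav_of_btw h1 (hd.btw_trans h2 hb).1
  exact h.imp (key _ _) (key _ _)

/-- A ticket is strictly inside its arc and no vertex is, so a vertex `b` not before the ticket lies
behind the whole arc. -/
theorem on_restrict {p : Ticket d} {u b v : V} (h : p.On u v) (hb : Btw d u b v)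
    (hp : p.depth u ≤ d u b) : p.On u b := by
  have key : ∀ x y, Edge d x y → Trav d u x y v → d u x < d u b → Trav d u x y b := by
    intro x y he ht hx
    obtain ⟨h1, -, h2, -⟩ := hd.trav_btw ht
    rcases hd.edge_vertex he ht hb with h3 | h3
    · linarith
    · exact trav_of_btw h1 (hd.btw_linear h2 hb h3)
  obtain ⟨x, y, he, ht, h1, -, -, h2⟩ := hd.on_cases h
  have h3 := key x y he ht (by linarith)
  rcases h2 with ⟨rfl, rfl, -⟩ | ⟨rfl, rfl, -⟩
  · exact Or.inl h3
  · exact Or.inr h3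

theorem on_extend_left {p : Ticket d} {u a v : V} (h : p.On a v) (ha : Btw d u a v) :
    p.On u v ∧ p.depth u = d u a + p.depth a := by
  have h1 := hd.on_symm (hd.on_extend (hd.on_symm h) (hd.btw_symm ha))
  refine ⟨h1, ?_⟩
  have h2 := hd.on_depth_add h1
  have h3 := hd.on_depth_add h
  unfold Btw at ha
  linarith

theorem on_restrict_left {p : Ticket d} {u a v : V} (h : p.On u v) (ha : Btw d u a v)
    (hp : d u a ≤ p.depth u) : p.On a v ∧ p.depth u = d u a + p.depth a := by
  have h1 : p.On a v := by
    refine hd.on_symm (hd.on_restrict (hd.on_symm h) (hd.btw_symm ha) ?_)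
    have h2 := hd.on_depth_add h
    unfold Btw at ha
    rw [hd.comm v a]; linarith
  exact ⟨h1, (hd.on_extend_left h1 ha).2⟩

theorem exists_on [Finite V] {u v : V} {r : ℝ} (h0 : 0 < r) (hr : r ≤ d u v) :
    ∃ p : Ticket d, p.On u v ∧ |p.depth u - r| ≤ 1 / 192 := by
  obtain ⟨a, b, ⟨he, hab, har, hrb⟩, ht⟩ := hd.exists_crosses h0 hr
  have hl := hd.edge_one_le he
  have hab' := hab
  unfold Btw at hab'
  rcases lt_or_gt_of_ne he.1 with hlt | hlt
  · obtain ⟨i, hi, h⟩ := exists_offset (t := r - d u a) hl (by linarith) (by linarith)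
    refine ⟨⟨⟨(a, b), hlt, he⟩, ⟨i, hi⟩⟩, Or.inl ht, ?_⟩
    rw [hd.depth_of_btw_fst (by exact hab)]
    change |d u a + offset (d a b) (pieces (d a b)) i - r| ≤ _
    rwa [show d u a + offset (d a b) (pieces (d a b)) i - r
      = offset (d a b) (pieces (d a b)) i - (r - d u a) by ring]
  · rw [hd.comm] at hl
    obtain ⟨i, hi, h⟩ := exists_offset (t := d u b - r) hl (by linarith)
      (by rw [hd.comm b a]; linarith)
    refine ⟨⟨⟨(b, a), hlt, hd.edge_symm he⟩, ⟨i, hi⟩⟩, Or.inr ht, ?_⟩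
    rw [hd.depth_of_btw_snd (by exact hab)]
    change |d u a + d b a - offset (d b a) (pieces (d b a)) i - r| ≤ _
    rw [abs_sub_comm] at h
    rw [hd.comm a b] at hab'
    rwa [show d u a + d b a - offset (d b a) (pieces (d b a)) i - r
      = d u b - r - offset (d b a) (pieces (d b a)) i by linarith]

/-- Hubs are represented by the end `fst`, which may be the nearer or the farther end of the arc.
The order survives: tickets on one arc have the same `fst`, and distinct arcs do not overlap. -/
theorem on_fst_mono {p q : Ticket d} {u v : V} (hp : p.On u v) (hq : q.On u v)
    (h : p.depth u ≤ q.depth u) : d u p.fst ≤ d u q.fst := by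
  obtain ⟨a, b, he, ht, h1, h2, -, h3⟩ := hd.on_cases hp
  obtain ⟨a', b', he', ht', h1', h2', -, h3'⟩ := hd.on_cases hq
  rcases hd.edge_edge he ht he' ht' with ⟨rfl, rfl⟩ | h4 | h4
  · have l1 := p.fst_lt_snd
    have l2 := q.fst_lt_snd
    rcases h3 with ⟨e1, e2, -⟩ | ⟨e1, e2, -⟩ <;> rcases h3' with ⟨e3, e4, -⟩ | ⟨e3, e4, -⟩
    · rw [← e1, ← e3]
    · rw [← e1, ← e2] at l1
      rw [← e3, ← e4] at l2
      exact absurd l1 l2.asymm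
    · rw [← e1, ← e2] at l1
      rw [← e3, ← e4] at l2
      exact absurd l1 l2.asymm
    · rw [← e2, ← e4]
  · rcases h3 with ⟨e1, e2, -⟩ | ⟨e1, e2, -⟩ <;> rcases h3' with ⟨e3, e4, -⟩ | ⟨e3, e4, -⟩ <;>
      simp only [← e1, ← e2, ← e3, ← e4] <;> linarith
  · linarith

/-- On a common arc this is the spacing of the offsets; across different arcs the two margins `1 /
194` add up to `1 / 97`. -/
theorem on_sep {p q : Ticket d} {u v : V} (hp : p.On u v) (hq : q.On u v) (hpq : p ≠ q) :
    1 / 97 ≤ |p.depth u - q.depth u| := by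
  obtain ⟨a, b, he, ht, h1, h2, -, h3⟩ := hd.on_cases hp
  obtain ⟨a', b', he', ht', h1', h2', -, h3'⟩ := hd.on_cases hq
  rcases hd.edge_edge he ht he' ht' with ⟨rfl, rfl⟩ | h4 | h4
  · have l1 := p.fst_lt_snd
    have l2 := q.fst_lt_snd
    have key : p.fst = q.fst → p.snd = q.snd → 1 / 97 ≤ |p.off - q.off| := by
      intro e1 e2
      obtain ⟨e, i⟩ := p
      obtain ⟨e', j⟩ := q
      obtain rfl : e = e' := Subtype.ext (Prod.ext e1 e2)
      exact offset_sep (hd.edge_one_le e.2.2) (by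
        intro hij; exact hpq (congrArg (Sigma.mk e) (Fin.ext hij)))
    rcases h3 with ⟨e1, e2, e5⟩ | ⟨e1, e2, e5⟩ <;> rcases h3' with ⟨e3, e4, e6⟩ | ⟨e3, e4, e6⟩
    · rw [e5, e6, add_sub_add_left_eq_sub]
      exact key (e1.symm.trans e3) (e2.symm.trans e4)
    · rw [← e1, ← e2] at l1
      rw [← e3, ← e4] at l2
      exact absurd l1 l2.asymm
    · rw [← e1, ← e2] at l1
      rw [← e3, ← e4] at l2
      exact absurd l1 l2.asymm
    · have e7 : d p.fst p.snd = d q.fst q.snd := by rw [← e1, ← e2, ← e3, ← e4]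
      rw [e5, e6, e7, sub_sub_sub_cancel_left, abs_sub_comm]
      exact key (e2.symm.trans e4) (e1.symm.trans e3)
  · rw [abs_sub_comm, abs_of_nonneg] <;> linarith
  · rw [abs_of_nonneg] <;> linarith

end IsGeodetic

/-! ### Counting tickets -/

section Count

variable [Fintype V]

open Classical in
/-- The tickets between `u` and `v` at distance between `x` and `y` from `u`. -/
def window (d : V → V → ℝ) (u v : V) (x y : ℝ) : Finset (Ticket d) :=
  Finset.univ.filter fun p => p.On u v ∧ x ≤ p.depth u ∧ p.depth u ≤ y

theorem mem_window {u v : V} {x y : ℝ} {p : Ticket d} :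
    p ∈ window d u v x y ↔ p.On u v ∧ x ≤ p.depth u ∧ p.depth u ≤ y := by
  simp [window]

variable (hd : IsGeodetic d)
include hd

/-- Tickets are `1 / 97` apart, so cells of that length separate them. -/
theorem card_window_le {u v : V} {x y : ℝ} (hxy : x ≤ y) :
    ((window d u v x y).card : ℝ) ≤ 97 * (y - x) + 1 := by
  have h : (window d u v x y).card ≤ (Finset.range (⌊97 * (y - x)⌋₊ + 1)).card := by
    refine Finset.card_le_card_of_injOn (fun p => ⌊97 * (p.depth u - x)⌋₊) ?_ ?_
    · intro p hp
      obtain ⟨-, h1, h2⟩ := mem_window.mp (Finset.mem_coe.mp hp)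
      simp only [Finset.coe_range, Set.mem_Iio]
      exact Nat.lt_succ_of_le (Nat.floor_le_floor (by linarith))
    · intro p hp q hq hpq
      obtain ⟨h1, h2, -⟩ := mem_window.mp (Finset.mem_coe.mp hp)
      obtain ⟨h1', h2', -⟩ := mem_window.mp (Finset.mem_coe.mp hq)
      by_contra hne
      have h3 := hd.on_sep h1 h1' hne
      have h4 := Nat.floor_le (show 0 ≤ 97 * (p.depth u - x) by linarith)
      have h5 := Nat.lt_floor_add_one (97 * (p.depth u - x))
      have h6 := Nat.floor_le (show 0 ≤ 97 * (q.depth u - x) by linarith)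
      have h7 := Nat.lt_floor_add_one (97 * (q.depth u - x))
      simp only at hpq
      rw [hpq] at h4 h5
      rcases le_abs.mp h3 with h8 | h8 <;> linarith
  rw [Finset.card_range] at h
  have h2 := Nat.floor_le (show 0 ≤ 97 * (y - x) by linarith)
  have h3 : ((window d u v x y).card : ℝ) ≤ (⌊97 * (y - x)⌋₊ + 1 : ℕ) := by exact_mod_cast h
  push_cast at h3
  linarith

theorem le_card_window {u v : V} {x y : ℝ} (hx : 0 ≤ x) (hxy : x ≤ y) (hy : y ≤ d u v) :
    48 * (y - x) - 1 ≤ ((window d u v x y).card : ℝ) := by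
  set n := ⌊48 * (y - x)⌋₊ with hn
  have hn1 := Nat.floor_le (show 0 ≤ 48 * (y - x) by linarith)
  have hn2 := Nat.lt_floor_add_one (48 * (y - x))
  rw [← hn] at hn1 hn2
  -- The targets are `1 / 48` apart and `1 / 96` away from the ends of the window. Each is
  -- approximated within `1 / 192`, so the tickets found are distinct and remain in the window.
  have hex : ∀ i : Fin n, ∃ p : Ticket d, p.On u v ∧
      |p.depth u - (x + (2 * (i : ℝ) + 1) / 96)| ≤ 1 / 192 := by
    intro i
    have hi : ((i : ℕ) : ℝ) + 1 ≤ n := by exact_mod_cast i.2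
    exact hd.exists_on (by positivity) (by linarith)
  choose f hf using hex
  have h : (Finset.univ : Finset (Fin n)).card ≤ (window d u v x y).card := by
    refine Finset.card_le_card_of_injOn f ?_ ?_
    · intro i _
      obtain ⟨h1, h2⟩ := hf i
      have hi : ((i : ℕ) : ℝ) + 1 ≤ n := by exact_mod_cast i.2
      have hi0 : (0 : ℝ) ≤ ((i : ℕ) : ℝ) := Nat.cast_nonneg _
      rw [abs_le] at h2
      exact Finset.mem_coe.mpr (mem_window.mpr ⟨h1, by linarith, by linarith⟩)
    · intro i _ j _ hij
      have h2 := (hf i).2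
      have h3 := (hf j).2
      rw [hij, abs_le] at h2
      rw [abs_le] at h3
      by_contra hne
      have h4 : (1 : ℝ) ≤ |((i : ℕ) : ℝ) - (j : ℕ)| := by
        have : (1 : ℤ) ≤ |((i : ℕ) : ℤ) - (j : ℕ)| :=
          Int.one_le_abs (by have : (i : ℕ) ≠ j := fun h => hne (Fin.ext h)
                             omega)
        exact_mod_cast this
      rcases le_abs.mp h4 with h5 | h5 <;> linarith
  rw [Finset.card_univ, Fintype.card_fin] at h
  have h2 : (n : ℝ) ≤ (window d u v x y).card := by exact_mod_cast h
  linarith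

/-- Bounds the diameter by the number of tickets, which tells the long scales where to stop. -/
theorem dist_le_card_ticket (u v : V) : 48 * d u v ≤ Fintype.card (Ticket d) + 1 := by
  have h := le_card_window hd (u := u) (v := v) le_rfl (hd.nonneg u v) le_rfl
  have h2 : ((window d u v 0 (d u v)).card : ℝ) ≤ Fintype.card (Ticket d) := by
    exact_mod_cast Finset.card_le_univ _
  linarith

theorem card_ticket_le :
    (Fintype.card (Ticket d) : ℝ) ≤ 97 * ∑ e : OrientedEdge d, d e.1.1 e.1.2 := by
  rw [Fintype.card_sigma, Finset.mul_sum]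
  push_cast
  refine Finset.sum_le_sum fun e _ => ?_
  rw [Fintype.card_fin]
  exact pieces_le (hd.edge_one_le e.2.2)

end Count

end Tickets

/-! ### Random rankings -/

section Ranking

variable {Q : Type*} [Fintype Q] [DecidableEq Q]

open Classical in
/-- A given element of `A` comes first among `A` in at most a fraction `1 / |A|` of the rankings. -/
theorem card_mul_card_first_le (A : Finset Q) {x : Q} (hx : x ∈ A) :
    A.card * (Finset.univ.filter fun σ : Q ≃ Fin (Fintype.card Q) =>
      ∀ y ∈ A, σ x ≤ σ y).card ≤ Fintype.card (Q ≃ Fin (Fintype.card Q)) := by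
  set E : Q → Finset (Q ≃ Fin (Fintype.card Q)) := fun a =>
    Finset.univ.filter fun σ => ∀ y ∈ A, σ a ≤ σ y with hE
  have hcard : ∀ a ∈ A, (E x).card ≤ (E a).card := by
    intro a ha
    -- Exchanging `x` and `a` turns a ranking led by `x` into one led by `a`; by symmetry all
    -- members of `A` are equally likely to come first.
    refine Finset.card_le_card_of_injOn (fun σ => (Equiv.swap x a).trans σ) ?_ ?_
    · intro σ hσ
      simp only [hE, Finset.coe_filter, Finset.mem_univ, true_and, Set.mem_ofPred_eq,
        Equiv.trans_apply, Equiv.swap_apply_right] at hσ ⊢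
      intro y hy
      apply hσ
      rcases eq_or_ne y x with h | h
      · rw [h, Equiv.swap_apply_left]; exact ha
      · by_cases h' : y = a
        · rw [h', Equiv.swap_apply_right]; exact hx
        · rw [Equiv.swap_apply_of_ne_of_ne h h']; exact hy
    · intro σ _ τ _ h
      ext q
      have := congrArg (fun f : Q ≃ Fin (Fintype.card Q) => f (Equiv.swap x a q)) h
      simp only [Equiv.trans_apply, Equiv.swap_apply_self] at this
      rw [this]
  have hdisj : (A : Set Q).PairwiseDisjoint E := by
    intro a ha b hb hab
    rw [Function.onFun, Finset.disjoint_left]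
    intro σ h1 h2
    simp only [hE, Finset.mem_filter, Finset.mem_univ, true_and] at h1 h2
    exact hab (σ.injective (le_antisymm (h1 b hb) (h2 a ha)))
  calc A.card * (E x).card ≤ ∑ a ∈ A, (E a).card := by
        rw [← smul_eq_mul]; exact Finset.card_nsmul_le_sum _ _ _ hcard
    _ = (A.biUnion E).card := (Finset.card_biUnion hdisj).symm
    _ ≤ _ := Finset.card_le_univ _

-- The element `x` may lie outside `B`: adding it to the set does not change the event and only
-- enlarges the set.
open Classical in
theorem card_first_le (B : Finset Q) (x : Q) {β : ℝ} (hβ : 0 < β) (hB : β ≤ B.card) :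
    ((Finset.univ.filter fun σ : Q ≃ Fin (Fintype.card Q) => ∀ y ∈ B, σ x ≤ σ y).card : ℝ) ≤
      Fintype.card (Q ≃ Fin (Fintype.card Q)) / β := by
  have h1 := card_mul_card_first_le (insert x B) (Finset.mem_insert_self x B)
  have h2 : (Finset.univ.filter fun σ : Q ≃ Fin (Fintype.card Q) =>
      ∀ y ∈ insert x B, σ x ≤ σ y) = Finset.univ.filter fun σ => ∀ y ∈ B, σ x ≤ σ y := by
    ext σ; simp
  rw [h2] at h1
  rw [le_div_iff₀ hβ]
  have h3 : (B.card : ℝ) ≤ (insert x B).card := by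
    exact_mod_cast Finset.card_le_card (Finset.subset_insert x B)
  have h4 : ((insert x B).card : ℝ) * ((Finset.univ.filter
      fun σ : Q ≃ Fin (Fintype.card Q) => ∀ y ∈ B, σ x ≤ σ y).card : ℝ) ≤
      Fintype.card (Q ≃ Fin (Fintype.card Q)) := by exact_mod_cast h1
  refine le_trans ?_ h4
  rw [mul_comm]
  exact mul_le_mul_of_nonneg_right (hB.trans h3) (Nat.cast_nonneg _)

end Ranking

/-! ### Hubs chosen per cut arc -/

section Scales

variable {V : Type*} [LinearOrder V] [Fintype V] {d : V → V → ℝ}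

-- One ticket per head in the cut keeps labels within `k`; the ticket may depend on the head but not
-- on the far end of the geodesic.
omit [Fintype V] in
theorem exists_hub_sets {k : ℕ} (W : V → Finset V) (hW : ∀ u, (W u).card ≤ k)
    (P : V → V → Ticket d → Prop) (hP : ∀ u, ∀ b ∈ W u, ∃ p, P u b p) :
    ∃ N : V → Finset V, (∀ u, (N u).card ≤ k) ∧
      ∀ u, ∀ b ∈ W u, ∃ p, P u b p ∧ p.fst ∈ N u := by
  choose f hf using hP
  refine ⟨fun u => (W u).attach.image fun b => (f u b.1 b.2).fst, fun u => ?_, fun u b hb => ?_⟩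
  · exact Finset.card_image_le.trans (by rw [Finset.card_attach]; exact hW u)
  · exact ⟨f u b hb, hf u b hb, Finset.mem_image.mpr ⟨⟨b, hb⟩, Finset.mem_attach _ _, rfl⟩⟩

/-! ### One scale of short distances -/

open Classical in
/-- The tickets that come first in the window seen from the far end of some geodesic from `u` of
length between `R` and `5 R / 4`. -/
def leaders (R : ℝ) (σ : Ticket d ≃ Fin (Fintype.card (Ticket d))) (u : V) : Finset (Ticket d) :=
  Finset.univ.filter fun p => ∃ v, R ≤ d u v ∧ d u v < 5 / 4 * R ∧
    p ∈ window d v u (11 * R / 24) (2 * R / 3) ∧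
    ∀ q ∈ window d v u (11 * R / 24) (2 * R / 3), σ p ≤ σ q

open Classical in
/-- The tickets in the two blocks below depth `m q` on the geodesic from `u` to `b` that come
before one of the two blocks. -/
def records (d : V → V → ℝ) (q : ℝ) (u b : V) (m : ℕ)
    (σ : Ticket d ≃ Fin (Fintype.card (Ticket d))) : Finset (Ticket d) :=
  (window d u b ((m - 2) * q) (m * q)).filter fun p =>
    (∀ y ∈ window d u b ((m - 2) * q) ((m - 1) * q), σ p ≤ σ y) ∨
      ∀ y ∈ window d u b ((m - 1) * q) (m * q), σ p ≤ σ y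

theorem mem_records {q : ℝ} {u b : V} {m : ℕ} {p : Ticket d}
    {σ : Ticket d ≃ Fin (Fintype.card (Ticket d))} :
    p ∈ records d q u b m σ ↔ p ∈ window d u b ((m - 2) * q) (m * q) ∧
      ((∀ y ∈ window d u b ((m - 2) * q) ((m - 1) * q), σ p ≤ σ y) ∨
        ∀ y ∈ window d u b ((m - 1) * q) (m * q), σ p ≤ σ y) := by
  simp only [records, Finset.mem_filter]

variable (hd : IsGeodetic d) {k : ℕ}
include hd

/-- If a block seen from `u` lies inside the window seen from `v`, the leader of the window precedes
the whole block. The block is determined by `u` and the cut head `b`, so the dependence on `v`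
disappears. -/
theorem leaders_subset_aux {R : ℝ} (σ : Ticket d ≃ Fin (Fintype.card (Ticket d)))
    {u v b a : V} {p : Ticket d} {m : ℕ}
    (hp : p ∈ window d v u (11 * R / 24) (2 * R / 3))
    (hmin : ∀ q ∈ window d v u (11 * R / 24) (2 * R / 3), σ p ≤ σ q)
    (hc : Crosses d u (m * (R / 24)) a b) (ht : Trav d u a b v)
    (hlo : (m - 2) * (R / 24) ≤ p.depth u) (hhi : p.depth u ≤ m * (R / 24))
    (hblock : m * (R / 24) ≤ d u v - 11 * R / 24 ∧ d u v - 2 * R / 3 ≤ (m - 1) * (R / 24) ∨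
      (m - 1) * (R / 24) ≤ d u v - 11 * R / 24 ∧ d u v - 2 * R / 3 ≤ (m - 2) * (R / 24)) :
    p ∈ records d (R / 24) u b m σ := by
  obtain ⟨-, -, hbv, -⟩ := hd.trav_btw ht
  obtain ⟨hon, hp1, hp2⟩ := mem_window.mp hp
  have hon' := hd.on_symm hon
  rw [mem_records, mem_window]
  refine ⟨⟨hd.on_restrict hon' hbv (hhi.trans hc.2.2.2), hlo, hhi⟩, ?_⟩
  have key : ∀ x y, d u v - 2 * R / 3 ≤ x → y ≤ d u v - 11 * R / 24 →
      ∀ z ∈ window d u b x y, σ p ≤ σ z := by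
    intro x y hx hy z hz
    obtain ⟨hz1, hz2, hz3⟩ := mem_window.mp hz
    have hz4 := hd.on_extend hz1 hbv
    have hz5 := hd.on_depth_add hz4
    exact hmin z (mem_window.mpr ⟨hd.on_symm hz4, by linarith, by linarith⟩)
  rcases hblock with ⟨h3, h4⟩ | ⟨h3, h4⟩
  · exact Or.inr (key _ _ h4 h3)
  · exact Or.inl (key _ _ h4 h3)

-- With `q = R / 24`, the window covers depths from `d u v - 16 q` to `d u v - 11 q`. Its length `5
-- q` leaves room for a complete block of the grid next to the leader, on one side or the other.
open Classical in
theorem leaders_subset {R : ℝ} (hR : 1 ≤ R) (σ : Ticket d ≃ Fin (Fintype.card (Ticket d)))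
    (u : V) : leaders R σ u ⊆ (Finset.Icc 2 20).biUnion fun m : ℕ =>
      (cutSet d u (m * (R / 24)) (m * (R / 24) / 2)).biUnion fun b =>
        records d (R / 24) u b m σ := by
  intro p hp
  simp only [leaders, Finset.mem_filter, Finset.mem_univ, true_and] at hp
  obtain ⟨v, h1, h2, hp, hmin⟩ := hp
  obtain ⟨hon, hp1, hp2⟩ := mem_window.mp hp
  have hadd := hd.on_depth_add hon
  rw [hd.comm v u] at hadd
  set q := R / 24 with hq
  have hq0 : 0 < q := by positivity
  have hRq : R = 24 * q := by rw [hq]; ring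
  set j := ⌊p.depth u / q⌋₊ with hj
  have hj1 := Nat.floor_le (show 0 ≤ p.depth u / q from
    div_nonneg (by linarith) hq0.le)
  have hj2 := Nat.lt_floor_add_one (p.depth u / q)
  rw [← hj, le_div_iff₀ hq0] at hj1
  rw [← hj, div_lt_iff₀ hq0] at hj2
  -- The block after the one containing `p` is taken if it fits in the window, otherwise the one
  -- before. The condition `m * q ≤ 2 * d u v / 3` makes the cut at depth `m * q` a skeleton cut; in
  -- the second case it needs `d u v ≤ 30 q = 5 R / 4`, which is where the width of a scale comes
  -- from.
  have key : ∃ m : ℕ, m * q ≤ 2 * d u v / 3 ∧ (m - 2) * q ≤ p.depth u ∧ p.depth u ≤ m * q ∧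
      (m * q ≤ d u v - 11 * R / 24 ∧ d u v - 2 * R / 3 ≤ (m - 1) * q ∨
      (m - 1) * q ≤ d u v - 11 * R / 24 ∧ d u v - 2 * R / 3 ≤ (m - 2) * q) := by
    rcases le_or_gt (p.depth u + 2 * q) (d u v - 11 * R / 24) with h3 | h3
    · refine ⟨j + 2, ?_, ?_, ?_, Or.inl ⟨?_, ?_⟩⟩ <;> push_cast <;> linarith
    · refine ⟨j + 1, ?_, ?_, ?_, Or.inr ⟨?_, ?_⟩⟩ <;> push_cast <;> linarith
  obtain ⟨m, hm1, hm2, hm3, hm4⟩ := key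
  have hm5 : (1 : ℝ) < m := by
    by_contra hcon
    push Not at hcon
    have : (m : ℝ) * q ≤ 1 * q := by gcongr
    linarith
  have hm6 : (m : ℝ) < 21 := by
    by_contra hcon
    push Not at hcon
    have : 21 * q ≤ (m : ℝ) * q := by gcongr
    linarith
  have hm5' : 1 < m := by exact_mod_cast hm5
  have hm6' : m < 21 := by exact_mod_cast hm6
  obtain ⟨a, b, hc, ht⟩ := hd.exists_crosses (u := u) (v := v) (r := m * q) (by positivity)
    (by linarith)
  rw [Finset.mem_biUnion]
  refine ⟨m, Finset.mem_Icc.mpr ⟨by omega, by omega⟩, ?_⟩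
  rw [Finset.mem_biUnion]
  refine ⟨b, mem_cutSet.mpr ⟨⟨a, hc⟩, v, (hd.trav_btw ht).2.2.1, by linarith⟩, ?_⟩
  exact leaders_subset_aux hd σ hp hmin hc ht hm2 hm3 hm4

-- There are at most `10 * R` candidates. Each block has at least `R` tickets, so a candidate
-- precedes one of the two blocks with probability at most `2 / R`.
open Classical in
theorem sum_card_records_le {R : ℝ} (hR : 1 ≤ R) {u b : V} {m : ℕ} (hm : 2 ≤ m)
    (hb : m * (R / 24) ≤ d u b) :
    ∑ σ, ((records d (R / 24) u b m σ).card : ℝ) ≤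
      20 * Fintype.card (Ticket d ≃ Fin (Fintype.card (Ticket d))) := by
  have hm' : (2 : ℝ) ≤ m := by exact_mod_cast hm
  set S : ℝ := (Fintype.card (Ticket d ≃ Fin (Fintype.card (Ticket d))) : ℝ) with hS
  have hq0 : 0 < R / 24 := by positivity
  set W := window d u b ((m - 2) * (R / 24)) (m * (R / 24)) with hW
  set B₁ := window d u b ((m - 2) * (R / 24)) ((m - 1) * (R / 24)) with hB1
  set B₂ := window d u b ((m - 1) * (R / 24)) (m * (R / 24)) with hB2
  have hWc : (W.card : ℝ) ≤ 10 * R := by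
    have := card_window_le hd (u := u) (v := b) (x := (m - 2) * (R / 24)) (y := m * (R / 24))
      (by nlinarith)
    linarith
  have hB1c : R ≤ B₁.card := by
    have := le_card_window hd (u := u) (v := b) (x := (m - 2) * (R / 24))
      (y := (m - 1) * (R / 24)) (by nlinarith) (by nlinarith) (by nlinarith)
    linarith
  have hB2c : R ≤ B₂.card := by
    have := le_card_window hd (u := u) (v := b) (x := (m - 1) * (R / 24))
      (y := m * (R / 24)) (by nlinarith) (by nlinarith) (by nlinarith)
    linarith
  have hsum : ∑ σ, ((records d (R / 24) u b m σ).card : ℝ) = ∑ p ∈ W,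
      ((Finset.univ.filter fun σ : Ticket d ≃ Fin (Fintype.card (Ticket d)) =>
        (∀ y ∈ B₁, σ p ≤ σ y) ∨ ∀ y ∈ B₂, σ p ≤ σ y).card : ℝ) := by
    simp only [records, ← hW, ← hB1, ← hB2, Finset.card_filter]
    push_cast
    rw [Finset.sum_comm]
  rw [hsum]
  have hR0 : 0 < R := by linarith
  calc _ ≤ ∑ p ∈ W, (2 * S / R) := by
        refine Finset.sum_le_sum fun p _ => ?_
        rw [Finset.filter_or]
        have h1 := card_first_le B₁ p hR0 hB1c
        have h2 := card_first_le B₂ p hR0 hB2c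
        have h3 : (((Finset.univ.filter fun σ : Ticket d ≃ Fin (Fintype.card (Ticket d)) =>
            ∀ y ∈ B₁, σ p ≤ σ y) ∪ Finset.univ.filter fun σ => ∀ y ∈ B₂, σ p ≤ σ y).card : ℝ) ≤
            (Finset.univ.filter fun σ : Ticket d ≃ Fin (Fintype.card (Ticket d)) =>
              ∀ y ∈ B₁, σ p ≤ σ y).card + (Finset.univ.filter
              fun σ : Ticket d ≃ Fin (Fintype.card (Ticket d)) => ∀ y ∈ B₂, σ p ≤ σ y).card := by
          exact_mod_cast Finset.card_union_le _ _
        refine h3.trans ((add_le_add h1 h2).trans (le_of_eq ?_))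
        ring
    _ = W.card * (2 * S / R) := by rw [Finset.sum_const, nsmul_eq_mul]
    _ ≤ 10 * R * (2 * S / R) := by gcongr
    _ = 20 * S := by field_simp; ring

variable (hk : ∀ u r, 0 < r → (cutSet d u r (r / 2)).card ≤ k)
include hk

/-- The factor is `380 = 19 * 20`: depths `2 ≤ m ≤ 20`, at most `k` heads at each, and at most `20`
expected records per head. -/
theorem sum_card_leaders_le {R : ℝ} (hR : 1 ≤ R) (u : V) :
    ∑ σ, ((leaders (d := d) R σ u).card : ℝ) ≤
      380 * k * Fintype.card (Ticket d ≃ Fin (Fintype.card (Ticket d))) := by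
  classical
  set S : ℝ := (Fintype.card (Ticket d ≃ Fin (Fintype.card (Ticket d))) : ℝ) with hS
  have hq0 : 0 < R / 24 := by positivity
  calc _ ≤ ∑ σ, ∑ m ∈ Finset.Icc 2 20,
        ∑ b ∈ cutSet d u ((m : ℕ) * (R / 24)) (m * (R / 24) / 2),
          ((records d (R / 24) u b m σ).card : ℝ) := by
        refine Finset.sum_le_sum fun σ _ => ?_
        have h1 := Finset.card_le_card (leaders_subset hd hR σ u)
        have h2 : (leaders R σ u).card ≤ ∑ m ∈ Finset.Icc 2 20,
            ∑ b ∈ cutSet d u ((m : ℕ) * (R / 24)) (m * (R / 24) / 2),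
              (records d (R / 24) u b m σ).card :=
          h1.trans (Finset.card_biUnion_le.trans
            (Finset.sum_le_sum fun m _ => Finset.card_biUnion_le))
        exact_mod_cast h2
    _ = ∑ m ∈ Finset.Icc 2 20, ∑ b ∈ cutSet d u ((m : ℕ) * (R / 24)) (m * (R / 24) / 2),
          ∑ σ, ((records d (R / 24) u b m σ).card : ℝ) := by
        rw [Finset.sum_comm]
        refine Finset.sum_congr rfl fun m _ => ?_
        rw [Finset.sum_comm]
    _ ≤ ∑ m ∈ Finset.Icc 2 20, (k * (20 * S) : ℝ) := by
        refine Finset.sum_le_sum fun m hm => ?_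
        have hm2 := (Finset.mem_Icc.mp hm).1
        have hm0 : (0 : ℝ) < m := by exact_mod_cast (by omega : 0 < m)
        calc _ ≤ ∑ b ∈ cutSet d u ((m : ℕ) * (R / 24)) (m * (R / 24) / 2), (20 * S) := by
              refine Finset.sum_le_sum fun b hb => ?_
              obtain ⟨⟨a, hc⟩, -⟩ := mem_cutSet.mp hb
              exact sum_card_records_le hd hR hm2 hc.2.2.2
          _ ≤ _ := by
              rw [Finset.sum_const, nsmul_eq_mul]
              have : ((cutSet d u ((m : ℕ) * (R / 24)) (m * (R / 24) / 2)).card : ℝ) ≤ k := by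
                exact_mod_cast hk u _ (by positivity)
              gcongr
    _ = 380 * k * S := by
        rw [Finset.sum_const, Nat.card_Icc, nsmul_eq_mul]; push_cast; ring

/-- Labels of size at most `k` and `O(n k)` pairs serving all distances between `R` and
`5 R / 4`. -/
theorem exists_short_scale {R : ℝ} (hR : 1 ≤ R) :
    ∃ (N : V → Finset V) (M : Finset (Sym2 V)), (∀ v, (N v).card ≤ k) ∧
      (M.card : ℝ) ≤ 380 * Fintype.card V * k ∧
      ∀ u v, R ≤ d u v → d u v < 5 / 4 * R → ∃ y ∈ N v, s(u, y) ∈ M ∧ Btw d u y v := by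
  classical
  have hne : (Finset.univ : Finset (Ticket d ≃ Fin (Fintype.card (Ticket d)))).Nonempty :=
    ⟨Fintype.equivFin _, Finset.mem_univ _⟩
  -- Some ranking does at least as well as the average in the total over all `u`.
  obtain ⟨σ, -, hσ⟩ := Finset.exists_le_of_sum_le (s := Finset.univ)
    (f := fun σ => ∑ u : V, ((leaders (d := d) R σ u).card : ℝ))
    (g := fun _ => 380 * Fintype.card V * k) hne (by
      rw [Finset.sum_comm, Finset.sum_const, nsmul_eq_mul, Finset.card_univ]
      calc _ ≤ ∑ u : V, (380 * k *
            Fintype.card (Ticket d ≃ Fin (Fintype.card (Ticket d))) : ℝ) :=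
            Finset.sum_le_sum fun u _ => sum_card_leaders_le hd hk hR u
        _ = _ := by rw [Finset.sum_const, nsmul_eq_mul, Finset.card_univ]; ring)
  -- The window ends at the depth `2 * R / 3` of the cut, so all geodesics from `v` through the same
  -- head share it and one leader per head suffices.
  obtain ⟨N, hN, hNP⟩ := exists_hub_sets (d := d) (k := k)
    (fun v => cutSet d v (2 * R / 3) (2 * R / 3 / 2))
    (fun v => hk v _ (by positivity))
    (fun v b p => p ∈ window d v b (11 * R / 24) (2 * R / 3) ∧
      ∀ q ∈ window d v b (11 * R / 24) (2 * R / 3), σ p ≤ σ q) (by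
      intro v b hb
      obtain ⟨⟨a, hc⟩, -⟩ := mem_cutSet.mp hb
      have h1 := le_card_window hd (u := v) (v := b) (x := 11 * R / 24) (y := 2 * R / 3)
        (by linarith) (by linarith) hc.2.2.2
      have h2 : (0 : ℝ) < (window d v b (11 * R / 24) (2 * R / 3)).card := by linarith
      exact Finset.exists_min_image _ σ (Finset.card_pos.mp (by exact_mod_cast h2)))
  refine ⟨N, Finset.univ.biUnion fun u => (leaders R σ u).image fun p => s(u, p.fst), hN, ?_, ?_⟩
  · refine le_trans ?_ hσ
    have : (Finset.univ.biUnion fun u =>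
        (leaders R σ u).image fun p => s(u, p.fst)).card ≤ ∑ u : V, (leaders R σ u).card :=
      Finset.card_biUnion_le.trans (Finset.sum_le_sum fun u _ => Finset.card_image_le)
    exact_mod_cast this
  · intro u v h1 h2
    obtain ⟨a, b, hc, ht⟩ := hd.exists_crosses (u := v) (v := u) (r := 2 * R / 3)
      (by linarith) (by rw [hd.comm]; linarith)
    have hbu := (hd.trav_btw ht).2.2.1
    obtain ⟨p, ⟨hp, hmin⟩, hpN⟩ := hNP v b
      (mem_cutSet.mpr ⟨⟨a, hc⟩, u, hbu, by rw [hd.comm v u]; linarith⟩)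
    obtain ⟨hp1, hp2, hp3⟩ := mem_window.mp hp
    have hon := hd.on_extend hp1 hbu
    refine ⟨p.fst, hpN, ?_, hd.btw_symm (hd.on_btw hon)⟩
    rw [Finset.mem_biUnion]
    refine ⟨u, Finset.mem_univ _, Finset.mem_image_of_mem _ ?_⟩
    rw [leaders, Finset.mem_filter]
    refine ⟨Finset.mem_univ _, v, h1, h2, mem_window.mpr ⟨hon, hp2, hp3⟩, fun q hq => ?_⟩
    obtain ⟨hq1, hq2, hq3⟩ := mem_window.mp hq
    exact hmin q (mem_window.mpr
      ⟨hd.on_restrict hq1 hbu (hq3.trans hc.2.2.2), hq2, hq3⟩)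

end Scales

/-! ### Random samples -/

section Sampling

variable {Q : Type*} [Fintype Q] [DecidableEq Q]

/-- The colours of distinct elements are independent. With `T = {0}` this gives the probability of
being sampled, with the complement that of being missed. -/
theorem card_colorings (B : Finset Q) {m : ℕ} (T : Finset (Fin (m + 1))) :
    ((Finset.univ.filter fun f : Q → Fin (m + 1) => ∀ x ∈ B, f x ∈ T).card : ℝ) =
      Fintype.card (Q → Fin (m + 1)) * (T.card / (m + 1)) ^ B.card := by
  have h1 : (Finset.univ.filter fun f : Q → Fin (m + 1) => ∀ x ∈ B, f x ∈ T) =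
      Fintype.piFinset fun x => if x ∈ B then T else Finset.univ := by
    ext f
    simp only [Finset.mem_filter, Finset.mem_univ, true_and, Fintype.mem_piFinset]
    refine forall_congr' fun x => ?_
    split_ifs with h <;> simp [h]
  have h2 : ∀ x : Q, (((if x ∈ B then T else Finset.univ).card : ℕ) : ℝ) =
      (m + 1) * if x ∈ B then (T.card / (m + 1) : ℝ) else 1 := by
    intro x
    split_ifs
    · field_simp
    · simp
  rw [h1, Fintype.card_piFinset]
  push_cast
  rw [Finset.prod_congr rfl fun x _ => h2 x, Finset.prod_mul_distrib, Finset.prod_ite_mem,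
    Finset.univ_inter, Finset.prod_const, Finset.prod_const]
  simp

/-- A random sample of density `1 / M` hits all sufficiently large sets and contains about a
fraction `1 / M ^ 2` of the given pairs. -/
theorem exists_sample {ι : Type*} [Fintype ι] (A : ι → Finset Q) (P : Finset (Q × Q))
    (hP : ∀ e ∈ P, e.1 ≠ e.2) {M s : ℕ} (hM : 0 < M) (hA : ∀ i, s ≤ (A i).card)
    (hs : 2 * Fintype.card ι * (1 - 1 / (M : ℝ)) ^ s ≤ 1) :
    ∃ X : Finset Q, (∀ i, ∃ x ∈ A i, x ∈ X) ∧
      ((P.filter fun e => e.1 ∈ X ∧ e.2 ∈ X).card : ℝ) ≤ 2 * (P.card / (M : ℝ) ^ 2) + 1 := by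
  classical
  obtain ⟨m, rfl⟩ : ∃ m, M = m + 1 := ⟨M - 1, by omega⟩
  set μ : ℝ := P.card / ((m + 1 : ℕ) : ℝ) ^ 2 with hμ
  set S : ℝ := (Fintype.card (Q → Fin (m + 1)) : ℝ) with hS
  have hS0 : 0 ≤ S := Nat.cast_nonneg _
  have hμ0 : 0 ≤ μ := by positivity
  have hm0 : (0 : ℝ) < (m : ℝ) + 1 := by positivity
  set F : (Q → Fin (m + 1)) → ℝ := fun f => ∑ e ∈ P, if f e.1 = 0 ∧ f e.2 = 0 then 1 else 0
    with hF
  set G : (Q → Fin (m + 1)) → ℝ := fun f => ∑ i, if ∀ x ∈ A i, f x ≠ 0 then 1 else 0 with hG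
  have hFsum : ∑ f, F f = S * μ := by
    rw [hF, Finset.sum_comm]
    have : ∀ e ∈ P, ∑ f : Q → Fin (m + 1), (if f e.1 = 0 ∧ f e.2 = 0 then (1 : ℝ) else 0) =
        S * (1 / (m + 1)) ^ 2 := by
      intro e he
      have h1 := card_colorings (Q := Q) {e.1, e.2} ({0} : Finset (Fin (m + 1)))
      rw [Finset.card_pair (hP e he)] at h1
      simp only [Finset.mem_insert, Finset.mem_singleton, forall_eq_or_imp, forall_eq,
        Finset.card_singleton, Nat.cast_one] at h1
      rw [← h1, Finset.card_filter]
      push_cast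
      rfl
    rw [Finset.sum_congr rfl this, Finset.sum_const, nsmul_eq_mul, hμ]
    push_cast
    field_simp
  have hGsum : ∑ f, G f ≤ S / 2 := by
    rw [hG, Finset.sum_comm]
    have : ∀ i ∈ (Finset.univ : Finset ι),
        ∑ f : Q → Fin (m + 1), (if ∀ x ∈ A i, f x ≠ 0 then (1 : ℝ) else 0) ≤
        S * (1 - 1 / ((m + 1 : ℕ) : ℝ)) ^ s := by
      intro i _
      have h1 := card_colorings (Q := Q) (A i) (Finset.univ.erase (0 : Fin (m + 1)))
      have h3 : ((Finset.univ.erase (0 : Fin (m + 1))).card : ℝ) / (m + 1) =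
          1 - 1 / ((m + 1 : ℕ) : ℝ) := by
        rw [Finset.card_erase_of_mem (Finset.mem_univ _), Finset.card_univ, Fintype.card_fin]
        push_cast [Nat.add_sub_cancel]
        field_simp
        ring
      rw [h3] at h1
      simp only [Finset.mem_erase, Finset.mem_univ, and_true] at h1
      have h4 : ∑ f : Q → Fin (m + 1), (if ∀ x ∈ A i, f x ≠ 0 then (1 : ℝ) else 0) =
          S * (1 - 1 / ((m + 1 : ℕ) : ℝ)) ^ (A i).card := by
        rw [← h1, Finset.card_filter]
        push_cast
        rfl
      rw [h4]
      have h5 : 1 / ((m + 1 : ℕ) : ℝ) ≤ 1 := by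
        rw [div_le_one (by positivity)]; push_cast; linarith [(Nat.cast_nonneg m : (0 : ℝ) ≤ m)]
      have h6 : 0 ≤ 1 / ((m + 1 : ℕ) : ℝ) := by positivity
      exact mul_le_mul_of_nonneg_left
        (pow_le_pow_of_le_one (by linarith) (by linarith) (hA i)) hS0
    refine (Finset.sum_le_sum this).trans ?_
    rw [Finset.sum_const, nsmul_eq_mul, Finset.card_univ]
    nlinarith
  -- One averaging handles both requirements. The expectation of `F` is `μ`, that of the number `G`
  -- of missed sets is at most `1 / 2`; the weight `2 * μ + 1` makes even one missed set exceed the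
  -- average.
  obtain ⟨f, -, hf⟩ := Finset.exists_le_of_sum_le (s := Finset.univ)
    (f := fun f => F f + (2 * μ + 1) * G f) (g := fun _ => 2 * μ + 1 / 2)
    ⟨fun _ => 0, Finset.mem_univ _⟩ (by
      rw [Finset.sum_add_distrib, ← Finset.mul_sum, hFsum, Finset.sum_const, nsmul_eq_mul,
        Finset.card_univ, ← hS]
      nlinarith)
  have hF0 : 0 ≤ F f := Finset.sum_nonneg fun e _ => by split_ifs <;> norm_num
  have hG0 : ∀ i, ¬ ∀ x ∈ A i, f x ≠ 0 := by
    intro i hi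
    have h1 : 1 ≤ G f := by
      have := Finset.single_le_sum (s := Finset.univ)
        (f := fun i => if ∀ x ∈ A i, f x ≠ 0 then (1 : ℝ) else 0)
        (fun i _ => by split_ifs <;> norm_num) (Finset.mem_univ i)
      simpa only [if_pos hi] using this
    nlinarith
  refine ⟨Finset.univ.filter fun x => f x = 0, fun i => ?_, ?_⟩
  · have := hG0 i
    push Not at this
    obtain ⟨x, hx, hx0⟩ := this
    exact ⟨x, hx, by simp [hx0]⟩
  · have h1 : 0 ≤ G f := Finset.sum_nonneg fun e _ => by split_ifs <;> norm_num
    have h2 : ((P.filter fun e => e.1 ∈ Finset.univ.filter (fun x => f x = 0) ∧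
        e.2 ∈ Finset.univ.filter fun x => f x = 0).card : ℝ) = F f := by
      simp only [hF, Finset.card_filter, Finset.mem_filter, Finset.mem_univ, true_and]
      push_cast
      rfl
    rw [h2]
    nlinarith

end Sampling

/-! ### One level of long distances -/

section Long

variable {V : Type*} [LinearOrder V] [Fintype V] {d : V → V → ℝ}

open Classical in
/-- The tickets on geodesics from `a` of length at most `S` that go on for at least `η`. -/
def farTickets (d : V → V → ℝ) (S η : ℝ) (a : V) : Finset (Ticket d) :=
  Finset.univ.filter fun q => ∃ v, q.On a v ∧ d a v ≤ S ∧ η ≤ q.depth v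

open Classical in
/-- The pairs of tickets that may have to be joined by a middle hop. -/
def farPairs (d : V → V → ℝ) (S η : ℝ) : Finset (Ticket d × Ticket d) :=
  Finset.univ.filter fun e => ∃ u v, d u v ≤ S ∧ e.1.On u v ∧ e.2.On u v ∧
    e.1.depth u < e.2.depth u ∧ η ≤ e.2.depth v

variable (hd : IsGeodetic d) {k : ℕ}
include hd

/-- Shortening the geodesic to start at the nearer end of the arc of the first ticket removes the
dependence on `u`, leaving two starting points per ticket. -/
theorem farPairs_subset (S η : ℝ) : farPairs d S η ⊆ Finset.univ.biUnion fun p : Ticket d =>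
    (farTickets d S η p.fst ∪ farTickets d S η p.snd).image fun q => (p, q) := by
  classical
  rintro ⟨p, q⟩ h
  simp only [farPairs, Finset.mem_filter, Finset.mem_univ, true_and] at h
  obtain ⟨u, v, hS, hp, hq, hpq, hη⟩ := h
  simp only [Finset.mem_biUnion, Finset.mem_univ, true_and, Finset.mem_image, Finset.mem_union,
    Prod.mk.injEq, farTickets, Finset.mem_filter]
  refine ⟨p, q, ?_, rfl, rfl⟩
  obtain ⟨a, b, -, ht, h1, -, -, h2⟩ := hd.on_cases hp
  have hav := (hd.trav_btw ht).2.1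
  have h3 := (hd.on_restrict_left hq hav (by linarith)).1
  have h4 : d a v ≤ S := by
    unfold Btw at hav
    linarith [hd.nonneg u a]
  rcases h2 with ⟨rfl, -, -⟩ | ⟨rfl, -, -⟩
  · exact Or.inl ⟨v, h3, h4, hη⟩
  · exact Or.inr ⟨v, h3, h4, hη⟩

variable (hk : ∀ u r, 0 < r → (cutSet d u r (r / 2)).card ≤ k)
include hk

theorem card_farTickets_le {R lam : ℝ} (hR : 1 ≤ R) (hl : 0 ≤ lam) {j : ℕ}
    (hj : 6 * lam ≤ 3 ^ j) (a : V) :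
    ((farTickets d (lam * R) (R / 6) a).card : ℝ) ≤ 120 * lam * R * k ^ (j + 1) := by
  classical
  -- Slices of thickness `h`, half of the guaranteed continuation `R / 6`: from a ticket in a slice
  -- the geodesic goes on for `h` past the end of the slice. There are at most `12 * lam` slices, `k
  -- ^ (j + 1)` heads at each, and `10 * R` tickets per head.
  set h := R / 12 with hh
  have hh0 : 0 < h := by positivity
  have hRh : R = 12 * h := by rw [hh]; ring
  have hsub : farTickets d (lam * R) (R / 6) a ⊆ (Finset.Icc 1 ⌊12 * lam⌋₊).biUnion fun m : ℕ =>
      (cutSet d a (m * h) h).biUnion fun b => window d a b ((m - 1) * h) (m * h) := by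
    intro q hq
    simp only [farTickets, Finset.mem_filter, Finset.mem_univ, true_and] at hq
    obtain ⟨v, hon, hv, hη⟩ := hq
    have hadd := hd.on_depth_add hon
    have hpos := hd.on_depth_pos hon
    set m := ⌈q.depth a / h⌉₊ with hm
    have hm1 : 0 < m := Nat.ceil_pos.mpr (by positivity)
    have hm2 := Nat.le_ceil (q.depth a / h)
    have hm3 := Nat.ceil_lt_add_one (show 0 ≤ q.depth a / h by positivity)
    rw [← hm, div_le_iff₀ hh0] at hm2
    rw [← hm, ← sub_lt_iff_lt_add, lt_div_iff₀ hh0] at hm3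
    have hm1' : (0 : ℝ) < m := by exact_mod_cast hm1
    obtain ⟨x, b, hc, ht⟩ := hd.exists_crosses (u := a) (v := v) (r := m * h) (by positivity)
      (by linarith)
    have hbv := (hd.trav_btw ht).2.2.1
    simp only [Finset.mem_biUnion, Finset.mem_Icc]
    refine ⟨m, ⟨hm1, ?_⟩, b, mem_cutSet.mpr ⟨⟨x, hc⟩, v, hbv, by linarith⟩,
      mem_window.mpr ⟨hd.on_restrict hon hbv (hm2.trans hc.2.2.2), hm3.le, hm2⟩⟩
    refine Nat.le_floor ?_
    have : (m : ℝ) * h ≤ 12 * lam * h := by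
      calc (m : ℝ) * h ≤ d a v := by linarith
        _ ≤ lam * R := hv
        _ = 12 * lam * h := by rw [hRh]; ring
    exact le_of_mul_le_mul_right this hh0
  have h1 : ((farTickets d (lam * R) (R / 6) a).card : ℝ) ≤
      ∑ m ∈ Finset.Icc 1 ⌊12 * lam⌋₊, ∑ b ∈ cutSet d a ((m : ℕ) * h) h,
        ((window d a b ((m - 1) * h) (m * h)).card : ℝ) := by
    have := (Finset.card_le_card hsub).trans (Finset.card_biUnion_le.trans
      (Finset.sum_le_sum fun m _ => Finset.card_biUnion_le))
    exact_mod_cast this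
  refine h1.trans ?_
  calc _ ≤ ∑ m ∈ Finset.Icc 1 ⌊12 * lam⌋₊, ((k : ℝ) ^ (j + 1) * (10 * R)) := by
        refine Finset.sum_le_sum fun m hm => ?_
        obtain ⟨hm1, hm2⟩ := Finset.mem_Icc.mp hm
        have hm1' : (0 : ℝ) < m := by exact_mod_cast hm1
        have hm2' : (m : ℝ) ≤ 12 * lam := (Nat.le_floor_iff (by positivity)).mp hm2
        calc _ ≤ ∑ b ∈ cutSet d a ((m : ℕ) * h) h, (10 * R) := by
              refine Finset.sum_le_sum fun b _ => ?_
              have := card_window_le hd (u := a) (v := b) (x := (m - 1) * h) (y := m * h)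
                (by nlinarith)
              linarith
          _ ≤ _ := by
              rw [Finset.sum_const, nsmul_eq_mul]
              have : ((cutSet d a ((m : ℕ) * h) h).card : ℝ) ≤ (k : ℝ) ^ (j + 1) := by
                exact_mod_cast card_cutSet_le hd hk j a _ h (by positivity) hh0 (by nlinarith)
              gcongr
    _ = (⌊12 * lam⌋₊ : ℝ) * ((k : ℝ) ^ (j + 1) * (10 * R)) := by
        rw [Finset.sum_const, nsmul_eq_mul, Nat.card_Icc, Nat.add_sub_cancel]
    _ ≤ 12 * lam * ((k : ℝ) ^ (j + 1) * (10 * R)) := by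
        have := Nat.floor_le (show 0 ≤ 12 * lam by positivity)
        gcongr
    _ = _ := by ring

theorem card_farPairs_le {R lam : ℝ} (hR : 1 ≤ R) (hl : 0 ≤ lam) {j : ℕ}
    (hj : 6 * lam ≤ 3 ^ j) :
    ((farPairs d (lam * R) (R / 6)).card : ℝ) ≤
      Fintype.card (Ticket d) * (240 * lam * R * k ^ (j + 1)) := by
  classical
  have h1 : ((farPairs d (lam * R) (R / 6)).card : ℝ) ≤ ∑ p : Ticket d,
      (((farTickets d (lam * R) (R / 6) p.fst).card : ℝ) +
        (farTickets d (lam * R) (R / 6) p.snd).card) := by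
    have := (Finset.card_le_card (farPairs_subset hd (lam * R) (R / 6))).trans
      (Finset.card_biUnion_le.trans (Finset.sum_le_sum fun p _ =>
        Finset.card_image_le.trans (Finset.card_union_le _ _)))
    exact_mod_cast this
  refine h1.trans ((Finset.sum_le_sum fun p _ => add_le_add
    (card_farTickets_le hd hk hR hl hj _) (card_farTickets_le hd hk hR hl hj _)).trans ?_)
  rw [Finset.sum_const, nsmul_eq_mul, Finset.card_univ]
  apply le_of_eq
  ring

/-- Labels of size at most `k` and few pairs serving all distances between `R` and `lam * R`. -/
theorem exists_long_scale {R lam : ℝ} (hn : 3 ≤ Fintype.card V)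
    (hRn : Real.log (Fintype.card V) ≤ R) (hl : 0 ≤ lam) {j : ℕ} (hj : 6 * lam ≤ 3 ^ j) :
    ∃ (N : V → Finset V) (M : Finset (Sym2 V)), (∀ v, (N v).card ≤ k) ∧
      (M.card : ℝ) ≤ 1920 * Fintype.card (Ticket d) * lam * k ^ (j + 1) *
        Real.log (Fintype.card V) ^ 2 / R + 1 ∧
      ∀ u v, R ≤ d u v → d u v < lam * R → ∃ x ∈ N u, ∃ y ∈ N v, s(x, y) ∈ M ∧
        d u x + d x y + d y v = d u v := by
  classical
  set n := Fintype.card V with hndef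
  have hn' : (3 : ℝ) ≤ n := by exact_mod_cast hn
  have hlog : 1 ≤ Real.log n := by
    rw [Real.le_log_iff_exp_le (by linarith)]
    linarith [Real.exp_one_lt_d9]
  have hR : 1 ≤ R := hlog.trans hRn
  -- The sample has density `1 / M`. Each window has at least `7 * R` tickets, so it is missed with
  -- probability at most `n ^ (-3)`, against at most `n ^ 2` windows.
  set M := ⌊R / Real.log n⌋₊ with hM
  have hM1 : 1 ≤ M := Nat.le_floor (by rw [Nat.cast_one, one_le_div (by linarith)]; exact hRn)
  have hM1' : (1 : ℝ) ≤ M := by exact_mod_cast hM1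
  have hMle := Nat.floor_le (show 0 ≤ R / Real.log n by positivity)
  have hMlt := Nat.lt_floor_add_one (R / Real.log n)
  rw [← hM, le_div_iff₀ (by linarith)] at hMle
  rw [← hM, div_lt_iff₀ (by linarith)] at hMlt
  have hbig : ∀ i : {x : V × V // x.2 ∈ cutSet d x.1 (R / 3) (R / 3 / 2)},
      ⌈7 * R⌉₊ ≤ (window d i.1.1 i.1.2 (R / 6) (R / 3)).card := by
    intro i
    obtain ⟨⟨a, hc⟩, -⟩ := mem_cutSet.mp i.2
    have := le_card_window hd (u := i.1.1) (v := i.1.2) (x := R / 6) (y := R / 3)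
      (by linarith) (by linarith) hc.2.2.2
    exact Nat.ceil_le.mpr (by linarith)
  obtain ⟨X, hX, hXP⟩ := exists_sample
    (ι := {x : V × V // x.2 ∈ cutSet d x.1 (R / 3) (R / 3 / 2)})
    (fun i => window d i.1.1 i.1.2 (R / 6) (R / 3)) (farPairs d (lam * R) (R / 6)) (by
      rintro e he h
      simp only [farPairs, Finset.mem_filter, Finset.mem_univ, true_and] at he
      obtain ⟨u, v, -, -, -, hlt, -⟩ := he
      rw [h] at hlt
      exact lt_irrefl _ hlt) hM1 hbig (by
      have h1 : (Fintype.card {x : V × V // x.2 ∈ cutSet d x.1 (R / 3) (R / 3 / 2)} : ℝ) ≤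
          (n : ℝ) ^ 2 := by
        have := Fintype.card_subtype_le fun x : V × V => x.2 ∈ cutSet d x.1 (R / 3) (R / 3 / 2)
        rw [Fintype.card_prod, ← hndef, ← pow_two] at this
        exact_mod_cast this
      have h2 : (1 - 1 / (M : ℝ)) ^ ⌈7 * R⌉₊ ≤ Real.exp (-(3 * Real.log n)) := by
        have h3 : 1 - 1 / (M : ℝ) ≤ Real.exp (-(1 / (M : ℝ))) := by
          have := Real.add_one_le_exp (-(1 / (M : ℝ)))
          linarith
        have h4 : 0 ≤ 1 - 1 / (M : ℝ) := by
          rw [sub_nonneg, div_le_one (by linarith)]; exact hM1'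
        calc _ ≤ Real.exp (-(1 / (M : ℝ))) ^ ⌈7 * R⌉₊ := pow_le_pow_left₀ h4 h3 _
          _ = Real.exp (-(⌈7 * R⌉₊ / M)) := by
            rw [← Real.exp_nat_mul]; congr 1; ring
          _ ≤ _ := by
            apply Real.exp_le_exp.mpr
            rw [neg_le_neg_iff, le_div_iff₀ (by linarith)]
            have := Nat.le_ceil (7 * R)
            nlinarith
      have h5 : Real.exp (-(3 * Real.log n)) = 1 / (n : ℝ) ^ 3 := by
        rw [Real.exp_neg, one_div]
        congr 1
        rw [show (3 : ℝ) * Real.log n = ((3 : ℕ) : ℝ) * Real.log n by norm_num, Real.exp_nat_mul,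
          Real.exp_log (by linarith)]
      rw [h5] at h2
      have h0 : 0 ≤ (1 - 1 / (M : ℝ)) ^ ⌈7 * R⌉₊ := by
        apply pow_nonneg
        rw [sub_nonneg, div_le_one (by linarith)]; exact hM1'
      calc _ ≤ 2 * (n : ℝ) ^ 2 * (1 / (n : ℝ) ^ 3) := by gcongr
        _ = 2 / n := by field_simp
        _ ≤ 1 := by rw [div_le_one (by linarith)]; linarith)
  obtain ⟨N, hN, hNP⟩ := exists_hub_sets (d := d) (k := k)
    (fun v => cutSet d v (R / 3) (R / 3 / 2)) (fun v => hk v _ (by positivity))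
    (fun v b p => p ∈ window d v b (R / 6) (R / 3) ∧ p ∈ X) (fun v b hb => hX ⟨(v, b), hb⟩)
  have hub : ∀ u v, R ≤ d u v → ∃ p : Ticket d, p.On u v ∧ R / 6 ≤ p.depth u ∧
      p.depth u ≤ R / 3 ∧ p ∈ X ∧ p.fst ∈ N u := by
    intro u v h1
    obtain ⟨a, b, hc, ht⟩ := hd.exists_crosses (u := u) (v := v) (r := R / 3)
      (by linarith) (by linarith)
    have hbv := (hd.trav_btw ht).2.2.1
    obtain ⟨p, ⟨hp, hpX⟩, hpN⟩ := hNP u b (mem_cutSet.mpr ⟨⟨a, hc⟩, v, hbv, by linarith⟩)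
    obtain ⟨hp1, hp2, hp3⟩ := mem_window.mp hp
    exact ⟨p, hd.on_extend hp1 hbv, hp2, hp3, hpX, hpN⟩
  refine ⟨N, ((farPairs d (lam * R) (R / 6)).filter fun e => e.1 ∈ X ∧ e.2 ∈ X).image
    fun e => s(e.1.fst, e.2.fst), hN, ?_, ?_⟩
  · have h1 : ((((farPairs d (lam * R) (R / 6)).filter fun e => e.1 ∈ X ∧ e.2 ∈ X).image
        fun e => s(e.1.fst, e.2.fst)).card : ℝ) ≤
        ((farPairs d (lam * R) (R / 6)).filter fun e => e.1 ∈ X ∧ e.2 ∈ X).card := by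
      exact_mod_cast Finset.card_image_le
    refine h1.trans (hXP.trans ?_)
    have h2 := card_farPairs_le hd hk hR hl hj
    have h3 : R / (2 * Real.log n) ≤ M := by
      rw [div_le_iff₀ (by linarith)]; nlinarith
    have h4 : 2 * (((farPairs d (lam * R) (R / 6)).card : ℝ) / (M : ℝ) ^ 2) ≤
        2 * (Fintype.card (Ticket d) * (240 * lam * R * k ^ (j + 1)) /
          (R / (2 * Real.log n)) ^ 2) := by
      gcongr
    refine add_le_add_left (h4.trans (le_of_eq ?_)) 1
    field_simp
    ring
  · intro u v h1 h2
    obtain ⟨p, hp, hp1, hp2, hpX, hpN⟩ := hub u v h1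
    obtain ⟨q, hq, hq1, hq2, hqX, hqN⟩ := hub v u (by rw [hd.comm]; exact h1)
    have hq' := hd.on_symm hq
    have hqadd := hd.on_depth_add hq'
    -- The hubs lie in the first and the last third of the geodesic, hence in this order; each is `R
    -- / 6` away from its own end.
    have hlt : p.depth u < q.depth u := by linarith
    refine ⟨p.fst, hpN, q.fst, hqN, Finset.mem_image.mpr ⟨(p, q), ?_, rfl⟩, ?_⟩
    · rw [Finset.mem_filter]
      refine ⟨?_, hpX, hqX⟩
      rw [farPairs, Finset.mem_filter]
      exact ⟨Finset.mem_univ _, u, v, h2.le, hp, hq', hlt, hq1⟩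
    · have h3 := hd.btw_linear (hd.on_btw hp) (hd.on_btw hq') (hd.on_fst_mono hp hq' hlt.le)
      have h4 := hd.on_btw hq'
      unfold Btw at h3 h4
      linarith

end Long

/-! ### All scales -/

/-- The pair `u, v` is served by labels `N` and middle hops `M`. -/
def Serves {V : Type*} (d : V → V → ℝ) (N : V → Finset V) (M : Finset (Sym2 V)) (u v : V) : Prop :=
  ∃ x ∈ N u, ∃ y ∈ N v, s(x, y) ∈ M ∧ d u x + d x y + d y v = d u v

theorem Serves.mono {V : Type*} {d : V → V → ℝ} {N N' : V → Finset V} {M M' : Finset (Sym2 V)}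
    {u v : V} (h : Serves d N M u v) (hN : ∀ u, N u ⊆ N' u) (hM : M ⊆ M') :
    Serves d N' M' u v := by
  obtain ⟨x, hx, y, hy, hxy, h⟩ := h
  exact ⟨x, hN u hx, y, hN v hy, hM hxy, h⟩

theorem exists_step {f : ℕ → ℝ} {x : ℝ} (h0 : f 0 ≤ x) (m : ℕ) (hm : x < f m) :
    ∃ i < m, f i ≤ x ∧ x < f (i + 1) := by
  induction m with
  | zero => exact absurd h0 (not_le.mpr hm)
  | succ m ih =>
    rcases lt_or_ge x (f m) with h | h
    · obtain ⟨i, hi, h⟩ := ih h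
      exact ⟨i, hi.trans (Nat.lt_succ_self m), h⟩
    · exact ⟨m, Nat.lt_succ_self m, h, hm⟩

/-- The growth exponent of the long scales. -/
def growthExp (k : ℕ) : ℕ := Nat.clog 3 k + 1

/-! ### Numerical estimates for the number of scales -/

theorem log_ge_of_three_le {n : ℕ} (hn : 3 ≤ n) : 1.09 ≤ Real.log n := by
  have hn' : (3 : ℝ) ≤ n := by exact_mod_cast hn
  have h1 : Real.log 3 ≤ Real.log n := Real.log_le_log (by norm_num) hn'
  have h2 := Real.one_sub_inv_le_log_of_pos (show 0 < 3 / Real.exp 1 by positivity)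
  rw [Real.log_div (by norm_num) (Real.exp_pos 1).ne', Real.log_exp, inv_div] at h2
  have := Real.exp_one_lt_d9
  linarith

theorem one_div_sixteen_le_log_log {n : ℕ} (hn : 3 ≤ n) :
    1 / 16 ≤ Real.log (Real.log n) := by
  have h1 := Real.log_le_log (by norm_num) (log_ge_of_three_le hn)
  have h2 := Real.one_sub_inv_le_log_of_pos (show (0 : ℝ) < 1.09 by norm_num)
  norm_num at h1 h2 ⊢
  linarith

/-- The number of short and long scales that are needed. -/
theorem exists_scale_counts {n k : ℕ} {T X : ℝ} (hn : 3 ≤ n) (hk2 : 2 ≤ k) (hT1 : 1 ≤ T)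
    (hX : Real.log k * Real.log (Real.log n) ≤ X) (hTX : Real.log T ≤ 270 * X) :
    ∃ I J : ℕ, 1920 * T * k * 18 ^ Nat.clog 3 k * Real.log n ^ 2 * 2 ^ growthExp k ≤
      (5 / 4 : ℝ) ^ I ∧ 2 * Real.log n ≤ (1 + 1 / (growthExp k : ℝ)) ^ J ∧
      (I : ℝ) + J ≤ 4750 * X ∧ 1 ≤ 24 * X := by
  have hn' : (3 : ℝ) ≤ n := by exact_mod_cast hn
  have hk2' : (2 : ℝ) ≤ k := by exact_mod_cast hk2
  have hl2 := Real.log_two_gt_d9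
  have hl2' := Real.log_two_lt_d9
  have hlk : Real.log 2 ≤ Real.log k := Real.log_le_log (by norm_num) hk2'
  have hlog := log_ge_of_three_le hn
  have hll := one_div_sixteen_le_log_log hn
  set l := Real.log k with hldef
  set ll := Real.log (Real.log n) with hlldef
  have hX1 : l ≤ 16 * X := by nlinarith
  have hX2 : 1 ≤ 24 * X := by linarith
  have hX3 : ll ≤ 3 / 2 * X := by nlinarith
  have hc3 : (Nat.clog 3 k : ℝ) ≤ l + 1 := by
    have h1 : 3 ^ (Nat.clog 3 k - 1) < k :=
      Nat.pow_pred_clog_lt_self (by norm_num) (by omega)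
    have hc0 : 0 < Nat.clog 3 k := Nat.clog_pos (by norm_num) hk2
    have h2 : ((3 : ℝ) ^ (Nat.clog 3 k - 1)) ≤ k := by exact_mod_cast h1.le
    have h3 := Real.log_le_log (by positivity) h2
    rw [Real.log_pow, Nat.cast_sub hc0] at h3
    have h4 : 1 ≤ Real.log 3 := by
      rw [Real.le_log_iff_exp_le (by norm_num)]
      linarith [Real.exp_one_lt_d9]
    have h5 : (0 : ℝ) ≤ (Nat.clog 3 k : ℝ) - (1 : ℕ) := by
      rw [sub_nonneg]; exact_mod_cast hc0
    push_cast at h3 h5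
    nlinarith
  have hg : (growthExp k : ℝ) ≤ 4 * l := by
    rw [growthExp]; push_cast; linarith
  have hg1 : (1 : ℝ) ≤ growthExp k := by
    rw [growthExp]; push_cast; linarith [(Nat.cast_nonneg (Nat.clog 3 k) : (0 : ℝ) ≤ _)]
  -- The factor `2 * growthExp k` compensates for `log (1 + 1 / g) ≥ 1 / (g + 1) ≥ 1 / (2 * g)`.
  set J := ⌈2 * growthExp k * Real.log (2 * Real.log n)⌉₊ with hJdef
  have hl2n : Real.log (2 * Real.log n) = Real.log 2 + ll :=
    Real.log_mul (by norm_num) (by linarith)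
  have hJ0 : (0 : ℝ) ≤ 2 * growthExp k * Real.log (2 * Real.log n) := by
    rw [hl2n]; positivity
  have hJ1 := Nat.le_ceil (2 * growthExp k * Real.log (2 * Real.log n))
  have hJ2 := (Nat.ceil_lt_add_one hJ0).le
  rw [← hJdef] at hJ1 hJ2
  have hJX : (J : ℝ) ≤ 200 * X := by
    have h1 : 2 * (growthExp k : ℝ) * Real.log (2 * Real.log n) ≤ 2 * (4 * l) * (13 * ll) := by
      rw [hl2n]; gcongr; linarith
    linarith
  have hJ : 2 * Real.log n ≤ (1 + 1 / (growthExp k : ℝ)) ^ J := by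
    have hθ : 0 < 1 + 1 / (growthExp k : ℝ) := by positivity
    rw [← Real.log_le_log_iff (by positivity) (by positivity), Real.log_pow]
    have h1 := Real.one_sub_inv_le_log_of_pos hθ
    have h2 : 1 / (2 * (growthExp k : ℝ)) ≤ 1 - (1 + 1 / (growthExp k : ℝ))⁻¹ := by
      rw [show 1 - (1 + 1 / (growthExp k : ℝ))⁻¹ = 1 / (growthExp k + 1) by field_simp; ring]
      apply one_div_le_one_div_of_le <;> linarith
    calc Real.log (2 * Real.log n)
        = 2 * growthExp k * Real.log (2 * Real.log n) * (1 / (2 * growthExp k)) := by field_simp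
      _ ≤ J * Real.log (1 + 1 / (growthExp k : ℝ)) := by
        apply mul_le_mul hJ1 (h2.trans h1) (by positivity) (Nat.cast_nonneg _)
  set R₀ : ℝ := 1920 * T * k * 18 ^ Nat.clog 3 k * Real.log n ^ 2 * 2 ^ growthExp k with hR0
  have hlogR : Real.log R₀ = Real.log 1920 + Real.log T + l + Nat.clog 3 k * Real.log 18 +
      2 * ll + growthExp k * Real.log 2 := by
    have : Real.log n ≠ 0 := by linarith
    rw [hR0, Real.log_mul (by positivity) (by positivity), Real.log_mul (by positivity)
      (by positivity), Real.log_mul (by positivity) (by positivity), Real.log_mul (by positivity)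
      (by positivity), Real.log_mul (by positivity) (by positivity), Real.log_pow, Real.log_pow,
      Real.log_pow]
    push_cast
    ring
  have hlogRX : Real.log R₀ ≤ 900 * X := by
    have h1 : Real.log 1920 ≤ 8 := by
      have : Real.log 1920 ≤ Real.log (2 ^ 11) := Real.log_le_log (by norm_num) (by norm_num)
      rw [Real.log_pow] at this
      push_cast at this
      linarith
    have h2 : Real.log 18 ≤ 4 := by
      have : Real.log 18 ≤ Real.log (2 ^ 5) := Real.log_le_log (by norm_num) (by norm_num)
      rw [Real.log_pow] at this
      push_cast at this
      linarith
    have h3 : (Nat.clog 3 k : ℝ) * Real.log 18 ≤ (l + 1) * 4 := by gcongr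
    have h4 : (growthExp k : ℝ) * Real.log 2 ≤ 4 * l * 1 := by gcongr; linarith
    linarith
  -- The factor `5` comes from `log (5 / 4) ≥ 1 / 5`.
  set I := ⌈5 * (900 * X)⌉₊ with hIdef
  have hI1 := Nat.le_ceil (5 * (900 * X))
  have hI2 := (Nat.ceil_lt_add_one (show 0 ≤ 5 * (900 * X) by linarith)).le
  rw [← hIdef] at hI1 hI2
  have hI : R₀ ≤ (5 / 4 : ℝ) ^ I := by
    rw [← Real.log_le_log_iff (by positivity) (by positivity), Real.log_pow]
    have h1 := Real.one_sub_inv_le_log_of_pos (show (0 : ℝ) < 5 / 4 by norm_num)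
    norm_num at h1
    nlinarith [(Nat.cast_nonneg I : (0 : ℝ) ≤ I)]
  exact ⟨I, J, hI, hJ, by linarith, hX2⟩

/-! ### Assembling the scales -/

section AllScales

variable {V : Type*} [LinearOrder V] [Fintype V] {d : V → V → ℝ} (hd : IsGeodetic d) {k : ℕ}
  (hk : ∀ u r, 0 < r → (cutSet d u r (r / 2)).card ≤ k)
include hd hk

theorem exists_short_scales (I : ℕ) :
    ∃ (N : V → Finset V) (M : Finset (Sym2 V)), (∀ v, (N v).card ≤ 1 + I * k) ∧
      (M.card : ℝ) ≤ Fintype.card V + I * (380 * Fintype.card V * k) ∧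
      ∀ u v, d u v < (5 / 4 : ℝ) ^ I → Serves d N M u v := by
  classical
  choose N M hN hM hNM using fun i : ℕ =>
    exists_short_scale hd hk (R := (5 / 4 : ℝ) ^ i) (one_le_pow₀ (by norm_num))
  -- At short scales the first hub is `u` itself, which is why `u` enters its own label; the loops
  -- serve the pairs `u, u`.
  refine ⟨fun u => {u} ∪ (Finset.range I).biUnion fun i => N i u,
    Finset.univ.image (fun u => s(u, u)) ∪ (Finset.range I).biUnion M, ?_, ?_, ?_⟩
  · intro u
    refine (Finset.card_union_le _ _).trans (Nat.add_le_add (by simp) ?_)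
    have := Finset.card_biUnion_le_card_mul (Finset.range I) (fun i => N i u) k (fun i _ => hN i u)
    rwa [Finset.card_range] at this
  · have h1 : ((Finset.univ.image (fun u : V => s(u, u)) ∪ (Finset.range I).biUnion M).card : ℝ) ≤
        (Finset.univ.image (fun u : V => s(u, u))).card +
          ((∑ i ∈ Finset.range I, (M i).card : ℕ) : ℝ) := by
      exact_mod_cast (Finset.card_union_le _ _).trans
        (Nat.add_le_add_left Finset.card_biUnion_le _)
    refine h1.trans (add_le_add ?_ ?_)
    · exact_mod_cast Finset.card_image_le
    · push_cast
      refine (Finset.sum_le_sum fun i _ => hM i).trans ?_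
      rw [Finset.sum_const, Finset.card_range, nsmul_eq_mul]
  · intro u v h
    by_cases huv : u = v
    · subst huv
      refine ⟨u, by simp, u, by simp, by simp, ?_⟩
      rw [hd.self]; ring
    · obtain ⟨i, hi, h1, h2⟩ := exists_step (f := fun i => (5 / 4 : ℝ) ^ i) (x := d u v)
        (by simpa using hd.one_le u v huv) I h
      obtain ⟨y, hy, hyM, hb⟩ := hNM i u v h1 (by rw [pow_succ] at h2; linarith)
      refine ⟨u, by simp, y, ?_, ?_, ?_⟩
      · simp only [Finset.mem_union, Finset.mem_biUnion, Finset.mem_range]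
        exact Or.inr ⟨i, hi, hy⟩
      · simp only [Finset.mem_union, Finset.mem_biUnion, Finset.mem_range]
        exact Or.inr ⟨i, hi, hyM⟩
      · rw [hd.self, zero_add]; exact hb

/-- The value of `R` is chosen to cancel the bound of `exists_long_scale` down to `n`, leaving a
linear number of hops. -/
theorem exists_long_scale' {T R lam : ℝ} (hn : 3 ≤ Fintype.card V) (hk1 : 1 ≤ k) (hT1 : 1 ≤ T)
    (hT : (Fintype.card (Ticket d) : ℝ) ≤ Fintype.card V * T) (hl : 1 ≤ lam)
    (hR : R = 1920 * T * k * 18 ^ Nat.clog 3 k * Real.log (Fintype.card V) ^ 2 *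
      lam ^ growthExp k) :
    ∃ (N : V → Finset V) (M : Finset (Sym2 V)), (∀ v, (N v).card ≤ k) ∧
      (M.card : ℝ) ≤ 2 * Fintype.card V ∧
      ∀ u v, R ≤ d u v → d u v < lam * R → Serves d N M u v := by
  set n := Fintype.card V with hndef
  have hn' : (3 : ℝ) ≤ n := by exact_mod_cast hn
  have hk1' : (1 : ℝ) ≤ k := by exact_mod_cast hk1
  have hlog : 1 ≤ Real.log n := by
    rw [Real.le_log_iff_exp_le (by linarith)]
    linarith [Real.exp_one_lt_d9]
  have h18 : (1 : ℝ) ≤ 18 ^ Nat.clog 3 k := one_le_pow₀ (by norm_num)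
  have hlg : 1 ≤ lam ^ growthExp k := one_le_pow₀ hl
  have hRn : Real.log n ≤ R := by
    rw [hR]
    calc Real.log n = 1 * 1 * 1 * 1 * (Real.log n * 1) * 1 := by ring
      _ ≤ 1920 * T * k * 18 ^ Nat.clog 3 k * (Real.log n * Real.log n) * lam ^ growthExp k := by
        gcongr; norm_num
      _ = _ := by ring
  obtain ⟨i, hi1, hi2⟩ := exists_nat_pow_near (show 1 ≤ 6 * lam by linarith)
    (show (1 : ℝ) < 3 by norm_num)
  obtain ⟨N, M, hN, hM, h⟩ := exists_long_scale hd hk hn hRn (by linarith) hi2.le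
  refine ⟨N, M, hN, hM.trans ?_, h⟩
  -- Base and exponent are exchanged through `k ≤ 3 ^ clog 3 k`: a power of `k` with exponent about
  -- `log_3 lam` becomes a power of `lam` with exponent `clog 3 k`.
  have hpow : (k : ℝ) ^ (i + 1 + 1) ≤ k * (18 ^ Nat.clog 3 k * lam ^ Nat.clog 3 k) := by
    have h1 : (k : ℝ) ≤ 3 ^ Nat.clog 3 k := by
      exact_mod_cast Nat.le_pow_clog (by norm_num) k
    have h2 : (3 : ℝ) ^ (i + 1) ≤ 18 * lam := by rw [pow_succ]; linarith
    calc (k : ℝ) ^ (i + 1 + 1) = k * k ^ (i + 1) := by rw [pow_succ]; ring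
      _ ≤ k * (3 ^ Nat.clog 3 k) ^ (i + 1) := by gcongr
      _ = k * (3 ^ (i + 1)) ^ Nat.clog 3 k := by rw [← pow_mul, ← pow_mul, mul_comm (i + 1)]
      _ ≤ k * (18 * lam) ^ Nat.clog 3 k := by gcongr
      _ = _ := by rw [mul_pow]
  have hR0 : 0 < R := by linarith
  have h1 : 1920 * (Fintype.card (Ticket d) : ℝ) * lam * k ^ (i + 1 + 1) * Real.log n ^ 2 / R ≤
      n := by
    rw [div_le_iff₀ hR0]
    calc _ ≤ 1920 * ((n : ℝ) * T) * lam * (k * (18 ^ Nat.clog 3 k * lam ^ Nat.clog 3 k)) *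
          Real.log n ^ 2 := by gcongr
      _ = n * R := by rw [hR, growthExp, pow_succ]; ring
  linarith

theorem exists_labels_of_scales {T : ℝ} (hn : 3 ≤ Fintype.card V) (hk1 : 1 ≤ k) (hT1 : 1 ≤ T)
    (hT : (Fintype.card (Ticket d) : ℝ) ≤ Fintype.card V * T) {I J : ℕ}
    (hI : 1920 * T * k * 18 ^ Nat.clog 3 k * Real.log (Fintype.card V) ^ 2 * 2 ^ growthExp k ≤
      (5 / 4 : ℝ) ^ I)
    (hJ : 2 * Real.log (Fintype.card V) ≤ (1 + 1 / (growthExp k : ℝ)) ^ J) :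
    ∃ (N : V → Finset V) (M : Finset (Sym2 V)), (∀ v, (N v).card ≤ 1 + (I + J) * k) ∧
      (M.card : ℝ) ≤ Fintype.card V + (I + J) * (380 * Fintype.card V * k) ∧
      ∀ u v, Serves d N M u v := by
  classical
  set n := Fintype.card V with hndef
  have hn' : (3 : ℝ) ≤ n := by exact_mod_cast hn
  have hk1' : (1 : ℝ) ≤ k := by exact_mod_cast hk1
  have hlog : 1 ≤ Real.log n := by
    rw [Real.le_log_iff_exp_le (by linarith)]
    linarith [Real.exp_one_lt_d9]
  set g := growthExp k with hg
  have hg0 : (0 : ℝ) < g := by rw [hg, growthExp]; positivity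
  set θ : ℝ := 1 + 1 / (g : ℝ) with hθ
  have hθ1 : 1 ≤ θ := by
    have : 0 < 1 / (g : ℝ) := by positivity
    linarith
  set T' : ℝ := 1920 * T * k * 18 ^ Nat.clog 3 k * Real.log n ^ 2 with hT'
  have h18 : (1 : ℝ) ≤ 18 ^ Nat.clog 3 k := one_le_pow₀ (by norm_num)
  have hTT' : T ≤ T' := by
    rw [hT']
    calc T = 1 * T * 1 * 1 * (1 * 1) := by ring
      _ ≤ 1920 * T * k * 18 ^ Nat.clog 3 k * (Real.log n * Real.log n) := by
        gcongr; norm_num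
      _ = _ := by ring
  -- Scale `i` covers distances from `T' * lam i ^ g` to `lam i` times that. The next scale starts
  -- there exactly if `lam (i + 1) = lam i ^ (1 + 1 / g)`.
  set lam : ℕ → ℝ := fun i => (2 : ℝ) ^ (θ ^ i : ℝ) with hlam
  have hlam1 : ∀ i, 1 ≤ lam i := fun i =>
    Real.one_le_rpow (by norm_num) (by positivity)
  have hstep : ∀ i, T' * lam (i + 1) ^ g = lam i * (T' * lam i ^ g) := by
    intro i
    have h1 : lam (i + 1) ^ g = lam i * lam i ^ g := by
      rw [hlam]
      simp only
      rw [← Real.rpow_mul_natCast (by norm_num), ← Real.rpow_mul_natCast (by norm_num),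
        ← Real.rpow_add (by norm_num)]
      congr 1
      rw [pow_succ, hθ]
      field_simp
      ring
    rw [h1]; ring
  choose N M hN hM hNM using fun i : ℕ =>
    exists_long_scale' hd hk hn hk1 hT1 hT (hlam1 i) rfl
  obtain ⟨N₀, M₀, hN₀, hM₀, hNM₀⟩ := exists_short_scales hd hk I
  refine ⟨fun u => N₀ u ∪ (Finset.range J).biUnion fun i => N i u,
    M₀ ∪ (Finset.range J).biUnion M, ?_, ?_, ?_⟩
  · intro u
    have := Finset.card_biUnion_le_card_mul (Finset.range J) (fun i => N i u) k (fun i _ => hN i u)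
    rw [Finset.card_range] at this
    refine (Finset.card_union_le _ _).trans ((Nat.add_le_add (hN₀ u) this).trans (le_of_eq ?_))
    ring
  · have h1 : ((M₀ ∪ (Finset.range J).biUnion M).card : ℝ) ≤
        M₀.card + ((∑ i ∈ Finset.range J, (M i).card : ℕ) : ℝ) := by
      exact_mod_cast (Finset.card_union_le _ _).trans
        (Nat.add_le_add_left Finset.card_biUnion_le _)
    have h2 : ((∑ i ∈ Finset.range J, (M i).card : ℕ) : ℝ) ≤ J * (380 * n * k) := by
      push_cast
      refine (Finset.sum_le_sum fun i _ => hM i).trans ?_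
      rw [Finset.sum_const, Finset.card_range, nsmul_eq_mul]
      have : (2 : ℝ) * n ≤ 380 * n * k := by nlinarith
      gcongr
    linarith
  · intro u v
    rcases lt_or_ge (d u v) ((5 / 4 : ℝ) ^ I) with h | h
    · exact (hNM₀ u v h).mono (fun _ => Finset.subset_union_left) Finset.subset_union_left
    · obtain ⟨i, hi, h1, h2⟩ := exists_step (f := fun i => T' * lam i ^ g) (x := d u v)
        (by
          refine le_trans ?_ (hI.trans h)
          simp [hlam]) J (by
          -- All distances are below `n * T`, and `lam J ≥ n` because `θ ^ J ≥ 2 * log n` and `2 *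
          -- log 2 ≥ 1`.
          have h3 := dist_le_card_ticket hd u v
          have h4 : (n : ℝ) ≤ lam J := by
            rw [hlam]
            simp only
            rw [Real.rpow_def_of_pos (by norm_num), ← Real.log_le_iff_le_exp (by linarith)]
            have := Real.log_two_gt_d9
            nlinarith
          have h5 : lam J ≤ lam J ^ g := le_self_pow₀ (hlam1 J) (by rw [hg, growthExp]; omega)
          calc d u v < n * T := by nlinarith
            _ ≤ lam J ^ g * T' := by gcongr; exact h4.trans h5
            _ = _ := mul_comm _ _)
      refine (hNM i u v h1 (by rw [hstep] at h2; exact h2)).mono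
        (fun _ => (Finset.subset_biUnion_of_mem (fun i => N i _)
          (Finset.mem_range.mpr hi)).trans Finset.subset_union_right)
        ((Finset.subset_biUnion_of_mem M (Finset.mem_range.mpr hi)).trans
          Finset.subset_union_right)

/-- Labels and middle hops serving all pairs, with logarithmic bounds. -/
theorem exists_labels {T X : ℝ} (hn : 3 ≤ Fintype.card V) (hk2 : 2 ≤ k) (hT1 : 1 ≤ T)
    (hT : (Fintype.card (Ticket d) : ℝ) ≤ Fintype.card V * T)
    (hX : Real.log k * Real.log (Real.log (Fintype.card V)) ≤ X)
    (hTX : Real.log T ≤ 270 * X) :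
    ∃ (N : V → Finset V) (M : Finset (Sym2 V)), (∀ v, ((N v).card : ℝ) ≤ 5000 * k * X) ∧
      (M.card : ℝ) ≤ 2000000 * (Fintype.card V * k * X) ∧ ∀ u v, Serves d N M u v := by
  set n := Fintype.card V with hndef
  have hk2' : (2 : ℝ) ≤ k := by exact_mod_cast hk2
  obtain ⟨I, J, hI, hJ, hIJ, hX2⟩ := exists_scale_counts hn hk2 hT1 hX hTX
  obtain ⟨N, M, hN, hM, h⟩ := exists_labels_of_scales hd hk hn (by omega) hT1 hT hI hJ
  have hkX : (I + J) * (k : ℝ) ≤ 4750 * X * k := by gcongr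
  have hX0 : 0 ≤ X := by linarith
  have hkX1 : 1 ≤ 24 * (k * X) := by nlinarith
  refine ⟨N, M, fun v => ?_, ?_, h⟩
  · have h1 : ((N v).card : ℝ) ≤ 1 + (I + J) * k := by exact_mod_cast hN v
    linarith
  · have h2 : (n : ℝ) * ((I + J) * k) ≤ n * (4750 * X * k) := by gcongr
    have h3 : (n : ℝ) * 1 ≤ n * (24 * (k * X)) := by gcongr
    linarith

end AllScales

/-! ### Unique shortest path graphs are geodetic -/

/-- Needed for `log k` to be bounded below. If cuts had width one, each point would have a single
first arc. For an arc from `u` to `b` and a third point `t`, the geodesic from `u` to `t` would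
start with `b` and the one from `b` to `t` with `u`, which is absurd. -/
theorem IsGeodetic.two_le_of_card {V : Type*} [Fintype V] {d : V → V → ℝ} (hd : IsGeodetic d)
    {k : ℕ} (hk : ∀ u r, 0 < r → (cutSet d u r (r / 2)).card ≤ k) (hn : 3 ≤ Fintype.card V) :
    2 ≤ k := by
  have first : ∀ u t : V, u ≠ t → ∃ b, Edge d u b ∧ Btw d u b t ∧
      b ∈ cutSet d u (1 / 2) (1 / 2 / 2) := by
    intro u t hut
    have h1 := hd.one_le u t hut
    obtain ⟨a, b, hc, ht⟩ := hd.exists_crosses (u := u) (v := t) (r := 1 / 2) (by norm_num)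
      (by linarith)
    obtain rfl : u = a := by
      by_contra hne
      linarith [hd.one_le u a hne, hc.2.2.1]
    have h2 := (hd.trav_btw ht).2.2.1
    exact ⟨b, hc.1, h2, mem_cutSet.mpr ⟨⟨u, hc⟩, t, h2, by linarith⟩⟩
  by_contra hlt
  have huniq : ∀ u b c : V, b ∈ cutSet d u (1 / 2) (1 / 2 / 2) →
      c ∈ cutSet d u (1 / 2) (1 / 2 / 2) → b = c := fun u b c hb hc =>
    Finset.card_le_one.mp ((hk u (1 / 2) (by norm_num)).trans (by omega)) b hb c hc
  obtain ⟨u, v, huv⟩ := Fintype.exists_pair_of_one_lt_card (show 1 < Fintype.card V by omega)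
  obtain ⟨b, hub, -, hb⟩ := first u v huv
  classical
  have : ∃ t, t ∉ ({u, b} : Finset V) := by
    by_contra hcon
    push Not at hcon
    have h1 : (Finset.univ : Finset V) ⊆ {u, b} := fun t _ => hcon t
    have h2 := (Finset.card_le_card h1).trans Finset.card_le_two
    rw [Finset.card_univ] at h2
    omega
  obtain ⟨t, ht⟩ := this
  simp only [Finset.mem_insert, Finset.mem_singleton, not_or] at ht
  obtain ⟨b', -, hb't, hb'⟩ := first u t (Ne.symm ht.1)
  obtain rfl := huniq u b b' hb hb'
  obtain ⟨c, -, hct, hc⟩ := first b t (Ne.symm ht.2)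
  obtain ⟨c', -, hcu', hc'⟩ := first b u hub.1.symm
  obtain rfl := huniq b c c' hc hc'
  obtain rfl : u = c := by
    rcases (hd.edge_symm hub).2 c hcu' with h | h
    · subst h
      obtain ⟨c'', hE, -, h3⟩ := first c u hub.1.symm
      exact absurd (huniq c c'' c h3 hc) hE.1.symm
    · exact h.symm
  unfold Btw at hct hb't
  rw [hd.comm b u] at hct
  linarith [hd.one_le u b hub.1]

/-! ### The shortest-path metric of a weighted graph -/

section Graph

variable {V : Type*} {G : SimpleGraph V} {w : Sym2 V → ℝ}

theorem walkLength_nil (u : V) : walkLength w (SimpleGraph.Walk.nil : G.Walk u u) = 0 := by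
  simp [walkLength]

theorem walkLength_cons {u v x : V} (h : G.Adj u v) (p : G.Walk v x) :
    walkLength w (SimpleGraph.Walk.cons h p) = w s(u, v) + walkLength w p := by
  simp [walkLength]

theorem walkLength_append {u v x : V} (p : G.Walk u v) (q : G.Walk v x) :
    walkLength w (p.append q) = walkLength w p + walkLength w q := by
  simp [walkLength, SimpleGraph.Walk.edges_append]

section

variable (hw : ∀ e ∈ G.edgeSet, 1 ≤ w e)
include hw

theorem walkLength_nonneg {u v : V} (p : G.Walk u v) : 0 ≤ walkLength w p := by
  refine List.sum_nonneg fun x hx => ?_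
  obtain ⟨e, he, rfl⟩ := List.mem_map.mp hx
  linarith [hw e (p.edges_subset_edgeSet he)]

theorem dist_le_walkLength {u v : V} (p : G.Walk u v) : dist G w u v ≤ walkLength w p :=
  ciInf_le ⟨0, by rintro _ ⟨q, rfl⟩; exact walkLength_nonneg hw q⟩ p

theorem dist_le_of_adj {u v : V} (h : G.Adj u v) : dist G w u v ≤ w s(u, v) := by
  have := dist_le_walkLength hw (SimpleGraph.Walk.cons h SimpleGraph.Walk.nil)
  rwa [walkLength_cons, walkLength_nil, add_zero] at this

theorem isShortest_iff {u v : V} (p : G.Walk u v) :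
    IsShortest w p ↔ walkLength w p = dist G w u v := by
  constructor
  · intro h
    have : Nonempty (G.Walk u v) := ⟨p⟩
    exact le_antisymm (le_ciInf h) (dist_le_walkLength hw p)
  · intro h q
    rw [h]
    exact dist_le_walkLength hw q

variable (hU : IsUSP G w)
include hU

theorem exists_shortest (u v : V) : ∃ p : G.Walk u v, walkLength w p = dist G w u v := by
  obtain ⟨p, hp, -⟩ := hU u v
  exact ⟨p, (isShortest_iff hw p).mp hp⟩

theorem dist_triangle (u x v : V) : dist G w u v ≤ dist G w u x + dist G w x v := by
  obtain ⟨p, hp⟩ := exists_shortest hw hU u x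
  obtain ⟨q, hq⟩ := exists_shortest hw hU x v
  rw [← hp, ← hq, ← walkLength_append]
  exact dist_le_walkLength hw _

theorem btw_of_mem_support {u v x : V} {p : G.Walk u v} (hp : IsShortest w p)
    (hx : x ∈ p.support) : Btw (dist G w) u x v := by
  classical
  have h1 := congrArg (walkLength w) (p.take_spec hx)
  rw [walkLength_append, (isShortest_iff hw p).mp hp] at h1
  have h2 := dist_le_walkLength hw (p.takeUntil x hx)
  have h3 := dist_le_walkLength hw (p.dropUntil x hx)
  exact le_antisymm (by linarith) (dist_triangle hw hU u x v)

omit hU in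
theorem isShortest_append {u v x : V} {p : G.Walk u x} {q : G.Walk x v} (hp : IsShortest w p)
    (hq : IsShortest w q) (h : Btw (dist G w) u x v) : IsShortest w (p.append q) := by
  rw [isShortest_iff hw] at *
  rw [walkLength_append, hp, hq]
  exact h

theorem onShortestPath_of_btw {u v x : V} (h : Btw (dist G w) u x v) :
    OnShortestPath G w u v x := by
  obtain ⟨p, hp, -⟩ := hU u x
  obtain ⟨q, hq, -⟩ := hU x v
  refine ⟨p.append q, isShortest_append hw hp hq h, ?_⟩
  rw [SimpleGraph.Walk.mem_support_append_iff]
  exact Or.inl p.end_mem_support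

theorem isGeodetic_dist : IsGeodetic (dist G w) where
  self u := by
    refine le_antisymm ?_ ?_
    · have := dist_le_walkLength hw (SimpleGraph.Walk.nil : G.Walk u u)
      rwa [walkLength_nil] at this
    · obtain ⟨p, hp⟩ := exists_shortest hw hU u u
      rw [← hp]
      exact walkLength_nonneg hw p
  comm := dist_comm G w
  tri := dist_triangle hw hU
  one_le u v huv := by
    obtain ⟨p, hp⟩ := exists_shortest hw hU u v
    rw [← hp]
    cases p with
    | nil => exact absurd rfl huv
    | cons h q =>
      rw [walkLength_cons]
      linarith [hw _ ((SimpleGraph.mem_edgeSet G).mpr h), walkLength_nonneg hw q]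
  linear u v x y hx hy hxy := by
    obtain ⟨p, hp, -⟩ := hU u x
    obtain ⟨q, hq, -⟩ := hU x v
    obtain ⟨r, hr, hr'⟩ := onShortestPath_of_btw hw hU hy
    -- The shortest path through `y` is by uniqueness the one through `x`. If `y` is on its first
    -- half, then `d u x ≤ d u y` forces `x = y`.
    have h1 : r = p.append q :=
      (hU u v).unique hr (isShortest_append hw hp hq hx)
    rw [h1, SimpleGraph.Walk.mem_support_append_iff] at hr'
    rcases hr' with h | h
    · have h2 := btw_of_mem_support hw hU hp h
      unfold Btw at h2
      have h3 := dist_triangle hw hU u x y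
      have h4 := dist_triangle hw hU x u y
      have h5 := dist_comm G w x y
      by_cases hne : x = y
      · subst hne
        have := dist_le_walkLength hw (SimpleGraph.Walk.nil : G.Walk x x)
        rw [walkLength_nil] at this
        linarith
      · linarith
    · have h2 := btw_of_mem_support hw hU hq h
      unfold Btw at h2
      linarith

/-- The shortest path between the ends can have no interior vertex, so it is a single edge. Edges of
`G` that are not shortest paths do not occur as arcs of the metric. -/
theorem adj_of_edge {a b : V} (h : Edge (dist G w) a b) :
    G.Adj a b ∧ w s(a, b) = dist G w a b := by
  obtain ⟨p, hp, -⟩ := hU a b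
  have hlen := (isShortest_iff hw p).mp hp
  cases p with
  | nil => exact absurd rfl h.1
  | @cons _ c _ hac q =>
    have hc : c ∈ (SimpleGraph.Walk.cons hac q).support := by simp
    rcases h.2 c (btw_of_mem_support hw hU hp hc) with rfl | rfl
    · exact absurd rfl hac.ne
    · refine ⟨hac, ?_⟩
      rw [walkLength_cons] at hlen
      exact le_antisymm (by linarith [walkLength_nonneg hw q]) (dist_le_of_adj hw hac)

/-- Cuts of the abstract metric are cuts of the skeleton. -/
theorem card_cutSet_le_skeletonDim [Fintype V] {k : ℕ} (hk : skeletonDim G w = k) (u : V) {r : ℝ}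
    (hr : 0 < r) : (cutSet (dist G w) u r (r / 2)).card ≤ k := by
  have hd := isGeodetic_dist hw hU
  have hex : ∀ b : cutSet (dist G w) u r (r / 2), ∃ x ∈ skeletonCut G w (1 / 2) u r,
      x.tgt = b.1 := by
    rintro ⟨b, hb⟩
    obtain ⟨⟨a, hE, hab, har, hrb⟩, v, hbv, hv⟩ := mem_cutSet.mp hb
    obtain ⟨hadj, hwab⟩ := adj_of_edge hw hU hE
    have hl := hd.one_le a b hE.1
    unfold Btw at hab
    obtain ⟨p, hp, -⟩ := hU u a
    have harc : TreeArc G w u a b := by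
      refine ⟨b, p.append (SimpleGraph.Walk.cons hadj SimpleGraph.Walk.nil),
        isShortest_append hw hp ?_ hab, ⟨(a, b), hadj⟩, ?_, rfl, rfl⟩
      · rw [isShortest_iff hw, walkLength_cons, walkLength_nil, add_zero, hwab]
      · simp
    have hf : (r - dist G w u a) / dist G w a b * w s(a, b) = r - dist G w u a := by
      rw [hwab]; field_simp
    refine ⟨⟨a, b, (r - dist G w u a) / dist G w a b, harc, by
      apply div_pos <;> linarith, by rw [div_le_one] <;> linarith⟩, ⟨?_, ?_⟩, rfl⟩
    · simp only [TreePoint.depth]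
      linarith
    · have hdepth : TreePoint.depth (G := G) (w := w) (u := u)
          ⟨a, b, (r - dist G w u a) / dist G w a b, harc, by
            apply div_pos <;> linarith, by rw [div_le_one] <;> linarith⟩ = r := by
        simp only [TreePoint.depth]
        linarith
      rw [TreePoint.reach, hdepth]
      refine le_trans ?_ (le_ciSup (f := fun z : {z : V // OnShortestPath G w u z b} =>
        dist G w u z - r) (Set.finite_range _).bddAbove ⟨v, onShortestPath_of_btw hw hU hbv⟩)
      simp only
      linarith
  choose f hf hft using hex
  have h1 : (cutSet (dist G w) u r (r / 2) : Set V).encard ≤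
      (skeletonCut G w (1 / 2) u r).encard := by
    -- Only surjectivity onto the heads is needed, so it does not matter whether points of the cut
    -- share a head.
    have himg : (cutSet (dist G w) u r (r / 2) : Set V) ⊆
        TreePoint.tgt '' skeletonCut G w (1 / 2) u r := fun b hb =>
      ⟨f ⟨b, hb⟩, hf ⟨b, hb⟩, hft ⟨b, hb⟩⟩
    exact (Set.encard_le_encard himg).trans (Set.encard_image_le _ _)
  have h2 : (skeletonCut G w (1 / 2) u r).encard ≤ (k : ℕ∞) := by
    rw [← hk]
    exact le_iSup_of_le u (le_iSup_of_le r (le_iSup_of_le hr le_rfl))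
  have h3 := h1.trans h2
  rw [Set.encard_coe_eq_coe_finsetCard] at h3
  exact_mod_cast h3

/-! ### The average edge length -/

variable [Fintype V]

/-- The linear order picks one orientation of each arc, so arcs inject into the edges with equal
length; the remaining edges only add to the right-hand side. -/
theorem sum_orientedEdge_le [LinearOrder V] (E : Finset (Sym2 V)) (hE : ∀ e, e ∈ E ↔ e ∈ G.edgeSet) :
    ∑ e : OrientedEdge (dist G w), dist G w e.1.1 e.1.2 ≤ ∑ e ∈ E, w e := by
  have h1 : ∀ e : OrientedEdge (dist G w), dist G w e.1.1 e.1.2 = w s(e.1.1, e.1.2) :=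
    fun e => (adj_of_edge hw hU e.2.2).2.symm
  have hinj : Function.Injective fun e : OrientedEdge (dist G w) => s(e.1.1, e.1.2) := by
    intro e e' h
    have l1 := e.2.1
    have l2 := e'.2.1
    simp only [Sym2.eq_iff] at h
    rcases h with ⟨h1, h2⟩ | ⟨h1, h2⟩
    · exact Subtype.ext (Prod.ext h1 h2)
    · rw [h1, h2] at l1
      exact absurd l1 l2.asymm
  rw [Finset.sum_congr rfl fun e _ => h1 e,
    ← Finset.sum_image (s := Finset.univ) (f := w)
      (g := fun e : OrientedEdge (dist G w) => s(e.1.1, e.1.2)) hinj.injOn]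
  refine Finset.sum_le_sum_of_subset_of_nonneg ?_ ?_
  · intro x hx
    obtain ⟨e, -, rfl⟩ := Finset.mem_image.mp hx
    exact (hE _).mpr ((SimpleGraph.mem_edgeSet G).mpr (adj_of_edge hw hU e.2.2).1)
  · intro e he _
    linarith [hw e ((hE e).mp he)]

/-- Half of the edges have at most twice the average length, so there are few edges. -/
theorem card_edges_le {k : ℕ} (hk : skeletonDim G w = k) (E : Finset (Sym2 V))
    (hE : ∀ e, e ∈ E ↔ e ∈ G.edgeSet) {L : ℝ} (hL0 : 0 < L)
    (hL : ∑ e ∈ E, w e = E.card * L) {j : ℕ} (hj : 2 * L < (4 / 3 : ℝ) ^ j) :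
    (E.card : ℝ) ≤ 2 * (Fintype.card V * (k + 1) ^ j) := by
  classical
  -- Markov's inequality; the short edges are then counted at one end, inside the ball of radius `2
  -- * L`.
  have h1 : ((E.filter fun e => ¬ w e ≤ 2 * L).card : ℝ) * (2 * L) ≤ E.card * L := by
    rw [← hL, ← nsmul_eq_mul]
    refine (Finset.card_nsmul_le_sum (E.filter fun e => ¬ w e ≤ 2 * L) w (2 * L) ?_).trans ?_
    · intro e he
      exact (not_le.mp (Finset.mem_filter.mp he).2).le
    · exact Finset.sum_le_sum_of_subset_of_nonneg (Finset.filter_subset _ _)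
        fun e he _ => by linarith [hw e ((hE e).mp he)]
  have h2 : ((E.filter fun e => w e ≤ 2 * L).card : ℝ) +
      (E.filter fun e => ¬ w e ≤ 2 * L).card = E.card := by
    exact_mod_cast Finset.card_filter_add_card_filter_not (s := E) (fun e => w e ≤ 2 * L)
  have h3 : (E.filter fun e => w e ≤ 2 * L).card ≤ Fintype.card V * (k + 1) ^ j := by
    have hsub : (E.filter fun e => w e ≤ 2 * L) ⊆ Finset.univ.biUnion fun u : V =>
        (Finset.univ.filter fun v => dist G w u v ≤ 2 * L).image fun v => s(u, v) := by
      intro e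
      induction e with | h a b => ?_
      intro he
      obtain ⟨he, hle⟩ := Finset.mem_filter.mp he
      have hadj := (SimpleGraph.mem_edgeSet G).mp ((hE _).mp he)
      simp only [Finset.mem_biUnion, Finset.mem_univ, true_and, Finset.mem_image,
        Finset.mem_filter]
      exact ⟨a, b, (dist_le_of_adj hw hadj).trans hle, rfl⟩
    refine (Finset.card_le_card hsub).trans ?_
    refine (Finset.card_biUnion_le_card_mul _ _ ((k + 1) ^ j) fun u _ =>
      Finset.card_image_le.trans ?_)
    exact card_ball_le (isGeodetic_dist hw hU)
      (fun u r hr => card_cutSet_le_skeletonDim hw hU hk u hr) j u _ hj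
  have h3' : ((E.filter fun e => w e ≤ 2 * L).card : ℝ) ≤ Fintype.card V * (k + 1) ^ j := by
    exact_mod_cast h3
  have h4 : 2 * ((E.filter fun e => ¬ w e ≤ 2 * L).card : ℝ) ≤ E.card := by
    have : (2 * ((E.filter fun e => ¬ w e ≤ 2 * L).card : ℝ)) * L ≤ E.card * L := by linarith
    exact le_of_mul_le_mul_right this hL0
  linarith

/-- Labels and middle hops for a unique shortest path graph. -/
theorem exists_graph_labels {k : ℕ} {L : ℝ} (hn : 3 ≤ Fintype.card V)
    (hk : skeletonDim G w = k) (hL : averageLength G w = L) :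
    2 ≤ k ∧ 1 ≤ L ∧ ∃ (N : V → Finset V) (M : Finset (Sym2 V)),
      (∀ v, ((N v).card : ℝ) ≤ 5000 * k *
        (Real.log k * (Real.log (Real.log (Fintype.card V)) + Real.log L))) ∧
      (M.card : ℝ) ≤ 2000000 * (Fintype.card V * k *
        (Real.log k * (Real.log (Real.log (Fintype.card V)) + Real.log L))) ∧
      ∀ u v, Serves (dist G w) N M u v := by
  classical
  -- Any order will do; it only serves to orient the arcs.
  let _ : LinearOrder V := LinearOrder.lift' (Fintype.equivFin V) (Fintype.equivFin V).injective
  have hd := isGeodetic_dist hw hU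
  have hcut : ∀ u r, 0 < r → (cutSet (dist G w) u r (r / 2)).card ≤ k :=
    fun u r hr => card_cutSet_le_skeletonDim hw hU hk u hr
  have hk2 := hd.two_le_of_card hcut hn
  have hk2' : (2 : ℝ) ≤ k := by exact_mod_cast hk2
  set E : Finset (Sym2 V) := (Set.toFinite G.edgeSet).toFinset with hEdef
  have hE : ∀ e, e ∈ E ↔ e ∈ G.edgeSet := fun e => by rw [hEdef, Set.Finite.mem_toFinset]
  have hE0 : 0 < E.card := by
    obtain ⟨u, v, huv⟩ := Fintype.exists_pair_of_one_lt_card (show 1 < Fintype.card V by omega)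
    have h1 := hd.one_le u v huv
    obtain ⟨a, b, hc, -⟩ := hd.exists_crosses (u := u) (v := v) (r := 1) (by norm_num) h1
    exact Finset.card_pos.mpr ⟨s(a, b), (hE _).mpr
      ((SimpleGraph.mem_edgeSet G).mpr (adj_of_edge hw hU hc.1).1)⟩
  have hE0' : (0 : ℝ) < E.card := by exact_mod_cast hE0
  have hsum : ∑ e ∈ E, w e = E.card * L := by
    rw [← hL, averageLength, finsum_mem_eq_finite_toFinset_sum _ (Set.toFinite G.edgeSet),
      Set.ncard_eq_toFinset_card _ (Set.toFinite G.edgeSet), ← hEdef]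
    field_simp
  have hL1 : 1 ≤ L := by
    have h1 : (E.card : ℝ) * 1 ≤ E.card * L := by
      rw [← hsum, ← nsmul_eq_mul]
      exact Finset.card_nsmul_le_sum _ _ _ fun e he => hw e ((hE e).mp he)
    exact le_of_mul_le_mul_left h1 hE0'
  refine ⟨hk2, hL1, ?_⟩
  obtain ⟨i, hi1, hi2⟩ := exists_nat_pow_near (show 1 ≤ 2 * L by linarith)
    (show (1 : ℝ) < 4 / 3 by norm_num)
  have hkp : (1 : ℝ) ≤ ((k : ℝ) + 1) ^ (i + 1) := one_le_pow₀ (by linarith)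
  have hcard := card_edges_le hw hU hk E hE (by linarith) hsum hi2
  have hl2 := Real.log_two_gt_d9
  have hl2' := Real.log_two_lt_d9
  have hlk : Real.log 2 ≤ Real.log k := Real.log_le_log (by norm_num) hk2'
  have hlL : 0 ≤ Real.log L := Real.log_nonneg hL1
  have hll := one_div_sixteen_le_log_log hn
  set l := Real.log k with hldef
  set ll := Real.log (Real.log (Fintype.card V)) with hlldef
  -- The factor `194 = 97 * 2` combines `97` tickets per unit of length with the factor `2` from
  -- `card_edges_le`.
  refine exists_labels hd hcut (T := 194 * L * ((k : ℝ) + 1) ^ (i + 1)) hn hk2 ?_ ?_ ?_ ?_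
  · calc (1 : ℝ) = 1 * 1 * 1 := by norm_num
      _ ≤ 194 * L * ((k : ℝ) + 1) ^ (i + 1) := by gcongr; norm_num
  · have h1 := (card_ticket_le hd).trans
      (mul_le_mul_of_nonneg_left (sum_orientedEdge_le hw hU E hE) (by norm_num))
    rw [hsum] at h1
    have h2 : (E.card : ℝ) * L ≤ 2 * (Fintype.card V * ((k : ℝ) + 1) ^ (i + 1)) * L := by gcongr
    linarith
  · rw [← hldef, ← hlldef]
    nlinarith
  · rw [Real.log_mul (by positivity) (by positivity), Real.log_mul (by norm_num) (by linarith),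
      Real.log_pow]
    have h1 : Real.log 194 ≤ 5.6 := by
      have : Real.log 194 ≤ Real.log (2 ^ 8) := Real.log_le_log (by norm_num) (by norm_num)
      rw [Real.log_pow] at this
      push_cast at this
      linarith
    have h2 : Real.log ((k : ℝ) + 1) ≤ 2 * l := by
      have : Real.log ((k : ℝ) + 1) ≤ Real.log ((k : ℝ) ^ 2) :=
        Real.log_le_log (by linarith) (by nlinarith)
      rw [Real.log_pow] at this
      exact_mod_cast this
    have h3 : (i : ℝ) ≤ 4 * (Real.log 2 + Real.log L) := by
      have h4 := Real.log_le_log (by positivity) hi1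
      rw [Real.log_pow, Real.log_mul (by norm_num) (by linarith)] at h4
      have h5 := Real.one_sub_inv_le_log_of_pos (show (0 : ℝ) < 4 / 3 by norm_num)
      norm_num at h5
      have h6 : (0 : ℝ) ≤ i := Nat.cast_nonneg i
      nlinarith
    have h7 : ((i + 1 : ℕ) : ℝ) * Real.log ((k : ℝ) + 1) ≤
        (4 * (Real.log 2 + Real.log L) + 1) * (2 * l) := by
      push_cast
      have : 0 ≤ Real.log ((k : ℝ) + 1) := Real.log_nonneg (by linarith)
      gcongr
    have h8 : l * (1 / 16) ≤ l * ll := by gcongr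
    have h9 : Real.log 2 * Real.log L ≤ l * Real.log L := by gcongr
    have h10 : Real.log 2 * l ≤ 0.6932 * l := by gcongr; linarith
    have h11 : 0 ≤ (Real.log 2 - 0.69) * Real.log L := mul_nonneg (by linarith) hlL
    linarith

end

end Graph

/-! ### Queries -/

section Scan

variable {V : Type*} (table : Sym2 V → Option ℝ)

theorem scanInner_time_le (x : V) (a : ℝ) (l : List (V × ℝ)) (best : WithTop ℝ) :
    (scanInner table x a l best).time ≤ 5 * l.length + 1 := by
  induction l generalizing best with
  | nil => simp [scanInner]
  | cons e l ih =>
    obtain ⟨y, b⟩ := e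
    rw [scanInner, List.length_cons]
    split
    · rename_i m _
      have := ih (min best ((a + m + b : ℝ) : WithTop ℝ))
      simp only
      omega
    · have := ih best
      simp only
      omega

theorem scanOuter_time_le (l₂ l : List (V × ℝ)) (best : WithTop ℝ) :
    (scanOuter table l₂ l best).time ≤ l.length * (5 * l₂.length + 2) + 1 := by
  induction l generalizing best with
  | nil => simp [scanOuter]
  | cons e l ih =>
    obtain ⟨x, a⟩ := e
    rw [scanOuter, List.length_cons, Nat.succ_mul]
    have h1 := scanInner_time_le table x a l₂ best
    have h2 := ih (scanInner table x a l₂ best).value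
    simp only
    omega

/-- Lower and upper bounds on the result of each loop replace an explicit formula for the minimum.
-/
theorem le_scanInner_value {c : WithTop ℝ} (x : V) (a : ℝ) (l : List (V × ℝ)) (best : WithTop ℝ)
    (hbest : c ≤ best)
    (h : ∀ e ∈ l, ∀ m, table s(x, e.1) = some m → c ≤ ((a + m + e.2 : ℝ) : WithTop ℝ)) :
    c ≤ (scanInner table x a l best).value := by
  induction l generalizing best with
  | nil => simpa [scanInner] using hbest
  | cons e l ih =>
    obtain ⟨y, b⟩ := e
    have hl := fun e he => h e (List.mem_cons_of_mem _ he)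
    rw [scanInner]
    split
    · rename_i m hm
      exact ih _ (le_min hbest (h (y, b) List.mem_cons_self m hm)) hl
    · exact ih _ hbest hl

theorem scanInner_value_le (x : V) (a : ℝ) (l : List (V × ℝ)) (best : WithTop ℝ) :
    (scanInner table x a l best).value ≤ best ∧
      ∀ e ∈ l, ∀ m, table s(x, e.1) = some m →
        (scanInner table x a l best).value ≤ ((a + m + e.2 : ℝ) : WithTop ℝ) := by
  induction l generalizing best with
  | nil => simp [scanInner]
  | cons e l ih =>
    obtain ⟨y, b⟩ := e
    rw [scanInner]
    split
    · rename_i m hm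
      obtain ⟨h1, h2⟩ := ih (min best ((a + m + b : ℝ) : WithTop ℝ))
      refine ⟨h1.trans (min_le_left _ _), fun e he m' hm' => ?_⟩
      rcases List.mem_cons.mp he with rfl | he
      · rw [hm] at hm'
        obtain rfl := Option.some.inj hm'
        exact h1.trans (min_le_right _ _)
      · exact h2 e he m' hm'
    · rename_i hm
      obtain ⟨h1, h2⟩ := ih best
      refine ⟨h1, fun e he m' hm' => ?_⟩
      rcases List.mem_cons.mp he with rfl | he
      · rw [hm] at hm'
        exact absurd hm' (by simp)
      · exact h2 e he m' hm'

theorem le_scanOuter_value {c : WithTop ℝ} (l₂ l : List (V × ℝ)) (best : WithTop ℝ)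
    (hbest : c ≤ best)
    (h : ∀ e ∈ l, ∀ e' ∈ l₂, ∀ m, table s(e.1, e'.1) = some m →
      c ≤ ((e.2 + m + e'.2 : ℝ) : WithTop ℝ)) :
    c ≤ (scanOuter table l₂ l best).value := by
  induction l generalizing best with
  | nil => simpa [scanOuter] using hbest
  | cons e l ih =>
    obtain ⟨x, a⟩ := e
    rw [scanOuter]
    exact ih _ (le_scanInner_value table x a l₂ best hbest (h (x, a) List.mem_cons_self))
      fun e he => h e (List.mem_cons_of_mem _ he)

theorem scanOuter_value_le (l₂ l : List (V × ℝ)) (best : WithTop ℝ) :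
    (scanOuter table l₂ l best).value ≤ best ∧
      ∀ e ∈ l, ∀ e' ∈ l₂, ∀ m, table s(e.1, e'.1) = some m →
        (scanOuter table l₂ l best).value ≤ ((e.2 + m + e'.2 : ℝ) : WithTop ℝ) := by
  induction l generalizing best with
  | nil => simp [scanOuter]
  | cons e l ih =>
    obtain ⟨x, a⟩ := e
    rw [scanOuter]
    obtain ⟨h1, h2⟩ := ih (scanInner table x a l₂ best).value
    obtain ⟨h3, h4⟩ := scanInner_value_le table x a l₂ best
    refine ⟨h1.trans h3, fun e he e' he' m hm => ?_⟩
    rcases List.mem_cons.mp he with rfl | he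
    · exact h1.trans (h4 e' he' m hm)
    · exact h2 e he e' he' m hm

end Scan

/-! ### Hopsets from labels -/

section Oracle

variable {V : Type*} {G : SimpleGraph V} {w : Sym2 V → ℝ} (hw : ∀ e ∈ G.edgeSet, 1 ≤ w e)
  (hU : IsUSP G w)
include hw hU

/-- No edge of the augmented graph is shorter than the distance of its ends, so the triangle
inequality applies along the walk. -/
theorem dist_le_augmented_walkLength (H : Set (Sym2 V)) {u v : V}
    (p : (G ⊔ SimpleGraph.fromEdgeSet H).Walk u v) :
    dist G w u v ≤ walkLength (augWeight G w H) p := by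
  induction p with
  | nil => rw [walkLength_nil, (isGeodetic_dist hw hU).self]
  | @cons a b c h p ih =>
    rw [walkLength_cons]
    have h1 : dist G w a b ≤ augWeight G w H s(a, b) := by
      unfold augWeight
      split_ifs with hH
      · exact le_rfl
      · rcases (SimpleGraph.sup_adj _ _ _ _).mp h with h | h
        · exact dist_le_of_adj hw h
        · exact absurd ((SimpleGraph.fromEdgeSet_adj H).mp h).1 hH
    linarith [dist_triangle hw hU a b c]

/-- A loop is realized by the empty walk, hence at most one edge rather than exactly one. -/
theorem exists_shortcut_walk {H : Set (Sym2 V)} {x y : V} (h : s(x, y) ∈ H) :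
    ∃ p : (G ⊔ SimpleGraph.fromEdgeSet H).Walk x y,
      p.length ≤ 1 ∧ walkLength (augWeight G w H) p = dist G w x y := by
  by_cases hxy : x = y
  · subst hxy
    exact ⟨SimpleGraph.Walk.nil, by simp, by
      rw [walkLength_nil, (isGeodetic_dist hw hU).self]⟩
  · have hadj : (G ⊔ SimpleGraph.fromEdgeSet H).Adj x y :=
      (SimpleGraph.sup_adj _ _ _ _).mpr (Or.inr ((SimpleGraph.fromEdgeSet_adj H).mpr ⟨h, hxy⟩))
    refine ⟨SimpleGraph.Walk.cons hadj SimpleGraph.Walk.nil, by simp, ?_⟩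
    rw [walkLength_cons, walkLength_nil, add_zero, augWeight, if_pos h]
    rfl

theorem isHopset_three {H : Set (Sym2 V)}
    (h : ∀ u v, ∃ x y, s(u, x) ∈ H ∧ s(x, y) ∈ H ∧ s(v, y) ∈ H ∧
      dist G w u x + dist G w x y + dist G w y v = dist G w u v) : IsHopset G w 3 H := by
  intro u v
  apply le_antisymm
  · obtain ⟨x, y, h1, h2, h3, h4⟩ := h u v
    obtain ⟨p, hp, hp'⟩ := exists_shortcut_walk hw hU h1
    obtain ⟨q, hq, hq'⟩ := exists_shortcut_walk hw hU h2
    rw [Sym2.eq_swap] at h3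
    obtain ⟨r, hr, hr'⟩ := exists_shortcut_walk hw hU h3
    have hlen : (p.append (q.append r)).length ≤ 3 := by
      rw [SimpleGraph.Walk.length_append, SimpleGraph.Walk.length_append]
      omega
    refine (iInf₂_le (p.append (q.append r)) hlen).trans (le_of_eq ?_)
    rw [walkLength_append, walkLength_append, hp', hq', hr', ← h4, add_assoc]
  · exact le_iInf₂ fun p _ => EReal.coe_le_coe_iff.mpr (dist_le_augmented_walkLength hw hU H p)

/-- The oracle given by labels and middle hops. -/
def oracleOfLabels [Fintype V] [DecidableEq V] (N : V → Finset V) (M : Finset (Sym2 V)) :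
    HopsetOracle V where
  arcs := Finset.univ.biUnion fun u => (N u).image fun x => (u, x)
  mid := M

omit hw hU

variable [Fintype V] [DecidableEq V]

theorem out_oracleOfLabels (N : V → Finset V) (M : Finset (Sym2 V)) (u : V) :
    (oracleOfLabels N M).out u = N u := by
  ext x
  simp [HopsetOracle.out, oracleOfLabels]

theorem mem_stored_oracleOfLabels (N : V → Finset V) (M : Finset (Sym2 V)) (u : V) (e : V × ℝ) :
    e ∈ (oracleOfLabels N M).stored G w u ↔ e.1 ∈ N u ∧ e.2 = dist G w u e.1 := by
  obtain ⟨x, a⟩ := e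
  simp only [HopsetOracle.stored, out_oracleOfLabels, List.mem_map, Finset.mem_toList,
    Prod.mk.injEq]
  constructor
  · rintro ⟨y, hy, rfl, rfl⟩
    exact ⟨hy, rfl⟩
  · rintro ⟨hy, rfl⟩
    exact ⟨x, hy, rfl, rfl⟩

theorem card_shortcuts_oracleOfLabels_le (N : V → Finset V) (M : Finset (Sym2 V)) :
    (oracleOfLabels N M).shortcuts.card ≤ ∑ u, (N u).card + M.card := by
  refine (Finset.card_union_le _ _).trans (Nat.add_le_add_right (Finset.card_image_le.trans ?_) _)
  exact Finset.card_biUnion_le.trans (Finset.sum_le_sum fun u _ => Finset.card_image_le)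

theorem time_query_oracleOfLabels_le (N : V → Finset V) (M : Finset (Sym2 V)) (u v : V) :
    ((oracleOfLabels N M).query G w u v).time ≤ (N u).card * (5 * (N v).card + 2) + 1 := by
  have := scanOuter_time_le ((oracleOfLabels N M).table G w)
    ((oracleOfLabels N M).stored G w v) ((oracleOfLabels N M).stored G w u) ⊤
  rw [HopsetOracle.query]
  refine this.trans (le_of_eq ?_)
  simp only [HopsetOracle.stored, out_oracleOfLabels, List.length_map, Finset.length_toList]

include hw hU

/-- A served pair attains the distance in the minimum, and by the triangle inequality no entry is
smaller. The same two hubs give the walk with three hops. -/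
theorem isExact_oracleOfLabels {N : V → Finset V} {M : Finset (Sym2 V)}
    (h : ∀ u v, Serves (dist G w) N M u v) : (oracleOfLabels N M).IsExact G w := by
  have harc : ∀ u x, x ∈ N u → s(u, x) ∈ ((oracleOfLabels N M).shortcuts : Set (Sym2 V)) := by
    intro u x hx
    refine Finset.mem_coe.mpr (Finset.mem_union_left _ (Finset.mem_image.mpr ⟨(u, x), ?_, rfl⟩))
    exact Finset.mem_biUnion.mpr ⟨u, Finset.mem_univ u, Finset.mem_image_of_mem _ hx⟩
  refine ⟨isHopset_three hw hU fun u v => ?_, fun u v => ?_⟩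
  · obtain ⟨x, hx, y, hy, hxy, hd⟩ := h u v
    exact ⟨x, y, harc u x hx, Finset.mem_coe.mpr (Finset.mem_union_right _ hxy), harc v y hy, hd⟩
  · apply le_antisymm
    · obtain ⟨x, hx, y, hy, hxy, hd⟩ := h u v
      have h1 := (scanOuter_value_le ((oracleOfLabels N M).table G w)
        ((oracleOfLabels N M).stored G w v) ((oracleOfLabels N M).stored G w u) ⊤).2
        (x, dist G w u x) ((mem_stored_oracleOfLabels N M u _).mpr ⟨hx, rfl⟩)
        (y, dist G w v y) ((mem_stored_oracleOfLabels N M v _).mpr ⟨hy, rfl⟩)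
        (dist G w x y) (if_pos hxy)
      refine h1.trans (le_of_eq ?_)
      rw [dist_comm G w v y, hd]
    · refine le_scanOuter_value _ _ _ _ le_top fun e he e' he' m hm => ?_
      obtain ⟨x, a⟩ := e
      obtain ⟨y, b⟩ := e'
      obtain ⟨-, ha⟩ := (mem_stored_oracleOfLabels N M u _).mp he
      obtain ⟨-, hb⟩ := (mem_stored_oracleOfLabels N M v _).mp he'
      have hm' : m = dist G w x y := by
        simp only [HopsetOracle.table] at hm
        split_ifs at hm with hmem
        exact (Option.some.inj hm).symm
      simp only at ha hb
      rw [ha, hb, hm', dist_comm G w v y, WithTop.coe_le_coe]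
      linarith [dist_triangle hw hU u x v, dist_triangle hw hU x y v]

end Oracle

end HopsetOracles

end

/-- The construction is derandomized: the rankings and samples used at each scale are fixed by
averaging, so the distribution is a point mass and the bound on the expected query time holds for
every query. -/
theorem mainTheorem1 :
    ∃ C : ℝ, 0 < C ∧
      ∀ (V : Type*) [Fintype V] [DecidableEq V] (G : SimpleGraph V) (w : Sym2 V → ℝ)
        (n k : ℕ) (L : ℝ),
        Fintype.card V = n → 3 ≤ n →
        (∀ e ∈ G.edgeSet, 1 ≤ w e) →
        HopsetOracles.IsUSP G w →
        HopsetOracles.skeletonDim G w = (k : ℕ∞) →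
        HopsetOracles.averageLength G w = L →
        ∃ μ : PMF (HopsetOracles.HopsetOracle V),
          -- with certainty: exactness, size, worst-case query time
          (∀ o ∈ μ.support,
            o.IsExact G w ∧
            (o.shortcuts.card : ℝ) ≤
              C * (n * k * Real.log k * (Real.log (Real.log n) + Real.log L)) ∧
            ∀ u v : V, ((o.query G w u v).time : ℝ) ≤
              C * ((k : ℝ) ^ 2 * Real.log k ^ 2 * Real.log (Real.log n) ^ 2 *
                  (Real.log (Real.log n) ^ 2 + Real.log L ^ 2) + Real.log n ^ 2)) ∧
          -- expected query time of every fixed pair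
          (∀ u v : V, ∑' o, μ o * ((o.query G w u v).time : ℝ≥0∞) ≤
            ENNReal.ofReal (C * ((k : ℝ) ^ 2 * Real.log k ^ 2 *
              (Real.log (Real.log n) ^ 2 + Real.log L ^ 2)))) := by
  -- The factor `256` absorbs the extra `log (log n) ^ 2` in the worst-case bound, which may be as
  -- small as `1 / 256` by the bound `log (log n) ≥ 1 / 16`.
  refine ⟨256 * 400000000, by norm_num, ?_⟩
  intro V _ _ G w n k L hn hn3 hw hU hk hL
  subst hn
  obtain ⟨hk2, hL1, N, M, hN, hM, hserve⟩ := HopsetOracles.exists_graph_labels hw hU hn3 hk hL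
  have hll := HopsetOracles.one_div_sixteen_le_log_log hn3
  have hk2' : (2 : ℝ) ≤ k := by exact_mod_cast hk2
  have hl : 0 < Real.log k := Real.log_pos (by linarith)
  have hlL : 0 ≤ Real.log L := Real.log_nonneg hL1
  have hexact := HopsetOracles.isExact_oracleOfLabels hw hU hserve
  have hsize := HopsetOracles.card_shortcuts_oracleOfLabels_le N M
  have htime := HopsetOracles.time_query_oracleOfLabels_le (G := G) (w := w) N M
  set n := Fintype.card V with hndef
  set l := Real.log k with hldef
  set ll := Real.log (Real.log n) with hlldef
  set lL := Real.log L with hlLdef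
  have hquery : ∀ u v, (((HopsetOracles.oracleOfLabels N M).query G w u v).time : ℝ) ≤
      400000000 * ((k : ℝ) ^ 2 * l ^ 2 * (ll ^ 2 + lL ^ 2)) := by
    intro u v
    set B : ℝ := 5000 * k * (l * (ll + lL)) with hB
    obtain ⟨x, hx, -⟩ := hserve u v
    obtain ⟨-, -, y, hy, -⟩ := hserve u v
    have h1 : (1 : ℝ) ≤ (N u).card := by exact_mod_cast Finset.card_pos.mpr ⟨x, hx⟩
    have h2 : (1 : ℝ) ≤ (N v).card := by exact_mod_cast Finset.card_pos.mpr ⟨y, hy⟩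
    have h3 : (((HopsetOracles.oracleOfLabels N M).query G w u v).time : ℝ) ≤
        (N u).card * (5 * (N v).card + 2) + 1 := by exact_mod_cast htime u v
    have hB1 : 1 ≤ B := h1.trans (hN u)
    calc _ ≤ ((N u).card : ℝ) * (5 * (N v).card + 2) + 1 := h3
      _ ≤ B * (5 * B + 2) + 1 := by
        have := hN u
        have := hN v
        gcongr
      -- Uses `1 ≤ B`, which holds because a label serving a pair is nonempty.
      _ ≤ 8 * B ^ 2 := by nlinarith
      _ = 200000000 * ((k : ℝ) ^ 2 * l ^ 2) * (ll + lL) ^ 2 := by rw [hB]; ring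
      _ ≤ 200000000 * ((k : ℝ) ^ 2 * l ^ 2) * (2 * (ll ^ 2 + lL ^ 2)) := by
        gcongr
        nlinarith [sq_nonneg (ll - lL)]
      _ = _ := by ring
  refine ⟨PMF.pure (HopsetOracles.oracleOfLabels N M), ?_, ?_⟩
  · intro o ho
    rw [PMF.support_pure, Set.mem_singleton_iff] at ho
    subst ho
    refine ⟨hexact, ?_, fun u v => (hquery u v).trans ?_⟩
    · have h1 : ((HopsetOracles.oracleOfLabels N M).shortcuts.card : ℝ) ≤
          ∑ u, ((N u).card : ℝ) + M.card := by exact_mod_cast hsize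
      have h2 : ∑ u, ((N u).card : ℝ) ≤ n * (5000 * k * (l * (ll + lL))) := by
        refine (Finset.sum_le_sum fun u _ => hN u).trans ?_
        rw [Finset.sum_const, nsmul_eq_mul, Finset.card_univ]
      have h3 : 0 ≤ (n : ℝ) * k * l * (ll + lL) := by positivity
      linarith
    · have h1 : (1 : ℝ) ≤ 256 * ll ^ 2 := by nlinarith
      have h2 : 0 ≤ (k : ℝ) ^ 2 * l ^ 2 * (ll ^ 2 + lL ^ 2) := by positivity
      have h3 : 0 ≤ Real.log n ^ 2 := sq_nonneg _
      nlinarith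
  · intro u v
    rw [tsum_eq_single (HopsetOracles.oracleOfLabels N M) fun o ho => by
      rw [PMF.pure_apply_of_ne _ _ ho, zero_mul], PMF.pure_apply_self, one_mul,
      ← ENNReal.ofReal_natCast]
    refine ENNReal.ofReal_le_ofReal ((hquery u v).trans ?_)
    have h2 : 0 ≤ (k : ℝ) ^ 2 * l ^ 2 * (ll ^ 2 + lL ^ 2) := by positivity
    linarith
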